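/- **Theorem 3.1.** Let $\alpha\in(0,1)$ be irrational. Put $v_\alpha(n)=\chi_{[1-\alpha,1)}(n\alpha \bmod 1)$ for $n\in\mathbb Z$, let $(T\tau)(n)=\tau(n+1)$ be the shift on $\{0,1\}^{\mathbb Z}$, and let $$\Omega_\alpha=\{\omega\in\{0,1\}^{\mathbb Z}:\ \omega=\lim_{i\to\infty} T^{n_i}v_\alpha \text{ pointwise for some integers } n_i\to\infty\}$$ be the Sturmian hull. There is exactly one Borel probability measure $\mu$ on $\Omega_\alpha$ which gives every cylinder set $\{\omega\in\Omega_\alpha:\ \omega(m+i)=b_i,\ 0\le i<l\}$ the frequency $$\lim_{n\to\infty}\frac1n\,\#\{1\le j\le n:\ v_\alpha(j)\cdots v_\alpha(j+l-1)=b_0\cdots b_{l-1}\}$$ (these limits exist). For $\lambda\in\mathbb R$ and $\omega\in\Omega_\alpha$ let $H_\omega$ be the operator on $\ell^2(\mathbb Z)$ given by $(H_\omega\phi)(n)=\phi(n+1)+\phi(n-1)+\lambda\,\omega(n)\phi(n)$. Then for every $\lambda\in\mathbb R$ there is a (necessarily unique) closed set $\Sigma\subseteq\mathbb R$ with $\sigma(H_\omega)=\Sigma$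 for $\mu$-almost every $\omega\in\Omega_\alpha$, and the stability set $$\Omega_\alpha^s=\{\omega\in\Omega_\alpha:\ \forall E\in\Sigma\ \exists\,\varepsilon\in\{+,-\}\text{ such that no nonzero solution }\phi:\mathbb Z\to\mathbb C\text{ of }(H_\omega-E)\phi=0\text{ is square-summable at }\varepsilon\infty\}$$ has positive measure, i.e. it contains a measurable set $B$ with $\mu(B)>0$. (Here a solution is any, not necessarily square-summable, $\phi$ with $\phi(n+1)+\phi(n-1)+\lambda\,\omega(n)\phi(n)=E\phi(n)$ for all $n\in\mathbb Z$.) -/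

import Mathlib

open Filter Topology MeasureTheory

noncomputable section

namespace Sturmian

/-! ### The hull and its measure -/

/-- Two-sided infinite sequences over the alphabet `{0, 1}`, with the product topology of the
discrete topologies and the product σ-algebra. -/
abbrev Seq : Type := ℤ → Fin 2

/-- The left shift `(T τ)(n) = τ(n + 1)`. -/
def shift (τ : Seq) : Seq := fun n => τ (n + 1)

open Classical in
/-- The sequence `v_α(n) = χ_{[1 - α, 1)}(n α mod 1)`. -/
def word (α : ℝ) : Seq := fun n =>
  if Int.fract ((n : ℝ) * α) ∈ Set.Ico (1 - α) 1 then 1 else 0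

/-- The Sturmian hull `Ω_α`: all pointwise limits of translates `T^{n_i} v_α` with `n_i → ∞`. -/
def hull (α : ℝ) : Set Seq :=
  {ω | ∃ k : ℕ → ℕ, Tendsto k atTop atTop ∧
    Tendsto (fun i => shift^[k i] (word α)) atTop (𝓝 ω)}

/-- The cylinder set `[w]_{[m, m + l - 1]}` in `Ω_α`. -/
def cylinder (α : ℝ) (m : ℤ) {l : ℕ} (w : Fin l → Fin 2) : Set (hull α) :=
  {ω | ∀ i : Fin l, ω.1 (m + (i : ℤ)) = w i}

/-- The number of `j` with `1 ≤ j ≤ n` such that the finite word `w` occurs in `v_α` at `j`. -/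
def occurrences (α : ℝ) {l : ℕ} (w : Fin l → Fin 2) (n : ℕ) : ℕ :=
  ((Finset.Icc 1 n).filter
    fun j : ℕ => ∀ i : Fin l, word α ((j : ℤ) + ((i : ℕ) : ℤ)) = w i).card

/-- `μ` is the measure of the hull: the Borel probability measure on `Ω_α` that gives every
cylinder set `[w]_{[m, m + l - 1]}` the frequency
`d(w) = lim_{n → ∞} n⁻¹ #{1 ≤ j ≤ n : w occurs in v_α at j}` (the limit has to exist). -/
def IsHullMeasure (α : ℝ) (μ : Measure (hull α)) : Prop :=
  IsProbabilityMeasure μ ∧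
    ∀ (m : ℤ) (l : ℕ) (w : Fin l → Fin 2),
      Tendsto (fun n : ℕ => (occurrences α w n : ℝ) / (n : ℝ)) atTop
        (𝓝 (μ.real (cylinder α m w)))

/-! ### Discrete Schrödinger operators on `ℓ²(ℤ)` -/

/-- The complex Hilbert space `ℓ²(ℤ)`. -/
abbrev EllTwo : Type := lp (fun _ : ℤ => ℂ) 2

lemma memℓp_translate (a : ℤ) (φ : EllTwo) : Memℓp (fun n : ℤ => φ (n + a)) 2 := by
  have hp : 0 < (2 : ENNReal).toReal := by norm_num
  refine memℓp_gen ?_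
  exact (Equiv.addRight a).summable_iff.2 ((lp.memℓp φ).summable hp)

/-- Translation `(S_a φ)(n) = φ(n + a)` on `ℓ²(ℤ)`. -/
def translate (a : ℤ) : EllTwo →L[ℂ] EllTwo :=
  LinearMap.mkContinuous
    { toFun := fun φ => ⟨fun n => φ (n + a), memℓp_translate a φ⟩
      map_add' := fun _ _ => rfl
      map_smul' := fun _ _ => rfl } 1 (by
    intro φ
    have hp : 0 < (2 : ENNReal).toReal := by norm_num
    rw [one_mul]
    refine lp.norm_le_of_tsum_le hp (norm_nonneg _) ?_
    rw [lp.norm_rpow_eq_tsum hp φ]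
    exact ((Equiv.addRight a).tsum_eq (fun n => ‖φ n‖ ^ (2 : ENNReal).toReal)).le)

lemma translate_apply (a : ℤ) (φ : EllTwo) (n : ℤ) : translate a φ n = φ (n + a) := rfl

lemma norm_mul_le {V : ℤ → ℝ} {C : ℝ} (hV : ∀ n, |V n| ≤ C) (φ : EllTwo) (n : ℤ) :
    ‖(V n : ℂ) * φ n‖ ≤ ‖((C : ℂ) • φ) n‖ := by
  rw [lp.coeFn_smul, Pi.smul_apply, norm_mul, norm_smul, Complex.norm_real, Complex.norm_real]
  exact mul_le_mul_of_nonneg_right ((hV n).trans (le_abs_self C)) (norm_nonneg _)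

lemma memℓp_mul {V : ℤ → ℝ} {C : ℝ} (hV : ∀ n, |V n| ≤ C) (φ : EllTwo) :
    Memℓp (fun n : ℤ => (V n : ℂ) * φ n) 2 :=
  memℓp_gen (Summable.of_nonneg_of_le (fun n => by positivity)
    (fun n => Real.rpow_le_rpow (norm_nonneg _) (norm_mul_le hV φ n) (by norm_num))
    ((lp.memℓp ((C : ℂ) • φ)).summable (by norm_num)))

/-- Multiplication by a bounded real sequence `V` on `ℓ²(ℤ)`. -/
def mulPotential (V : ℤ → ℝ) (C : ℝ) (hV : ∀ n, |V n| ≤ C) : EllTwo →L[ℂ] EllTwo :=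
  LinearMap.mkContinuous
    { toFun := fun φ => ⟨fun n => (V n : ℂ) * φ n, memℓp_mul hV φ⟩
      map_add' := fun φ ψ => by
        ext n
        exact mul_add _ _ _
      map_smul' := fun c φ => by
        ext n
        exact mul_left_comm _ _ _ } |C| (by
    intro φ
    have h := lp.norm_mono (p := 2) (by norm_num)
      (x := (⟨fun n => (V n : ℂ) * φ n, memℓp_mul hV φ⟩ : EllTwo)) (y := (C : ℂ) • φ)
      (norm_mul_le hV φ)
    rw [norm_smul, Complex.norm_real] at h
    exact h)

lemma mulPotential_apply (V : ℤ → ℝ) (C : ℝ) (hV : ∀ n, |V n| ≤ C) (φ : EllTwo) (n : ℤ) :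
    mulPotential V C hV φ n = (V n : ℂ) * φ n := rfl

/-- The discrete Schrödinger operator `(H φ)(n) = φ(n + 1) + φ(n - 1) + V(n) φ(n)` on `ℓ²(ℤ)`
with bounded real potential `V`. -/
def schrodinger (V : ℤ → ℝ) (C : ℝ) (hV : ∀ n, |V n| ≤ C) : EllTwo →L[ℂ] EllTwo :=
  translate 1 + translate (-1) + mulPotential V C hV

lemma schrodinger_apply (V : ℤ → ℝ) (C : ℝ) (hV : ∀ n, |V n| ≤ C) (φ : EllTwo) (n : ℤ) :
    schrodinger V C hV φ n = φ (n + 1) + φ (n - 1) + (V n : ℂ) * φ n := rfl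

/-- The potential `V_ω(n) = f(ω(n))`, where `f(0) = 0` and `f(1) = lam`. -/
def potential (lam : ℝ) (ω : Seq) : ℤ → ℝ := fun n => if ω n = 1 then lam else 0

lemma abs_potential_le (lam : ℝ) (ω : Seq) (n : ℤ) : |potential lam ω n| ≤ |lam| := by
  unfold potential
  split_ifs <;> simp

/-- The operator `H_ω` with coupling `lam`. -/
def sturmOp (lam : ℝ) (ω : Seq) : EllTwo →L[ℂ] EllTwo :=
  schrodinger (potential lam ω) |lam| (abs_potential_le lam ω)

/-- `S ⊆ ℝ` is the deterministic spectrum `Σ` of the family `(H_ω)`: it is closed and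
`σ(H_ω) = S` for `μ`-almost every `ω`. (There is at most one such set when `μ ≠ 0`.) -/
def IsAlmostSureSpectrum (α lam : ℝ) (μ : Measure (hull α)) (S : Set ℝ) : Prop :=
  IsClosed S ∧
    ∀ᵐ ω ∂μ, spectrum ℂ (sturmOp lam ω.1) = (fun E : ℝ => (E : ℂ)) '' S

/-! ### The stability set -/

/-- `φ` is a (not necessarily square-summable) solution of the difference equation
`φ(n + 1) + φ(n - 1) + V(n) φ(n) = E φ(n)`, `n ∈ ℤ`. -/
def IsSolution (V : ℤ → ℝ) (E : ℝ) (φ : ℤ → ℂ) : Prop :=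
  ∀ n : ℤ, φ (n + 1) + φ (n - 1) + (V n : ℂ) * φ n = (E : ℂ) * φ n

/-- Square-summability at `+∞`. -/
def SqSummableAtTop (φ : ℤ → ℂ) : Prop := Summable fun n : ℕ => ‖φ (n : ℤ)‖ ^ 2

/-- Square-summability at `-∞`. -/
def SqSummableAtBot (φ : ℤ → ℂ) : Prop := Summable fun n : ℕ => ‖φ (-(n : ℤ))‖ ^ 2

/-- The stability set `Ω_α^s` (for the deterministic spectrum `S`): the `ω ∈ Ω_α` such that for
every `E ∈ S` there is a sign `ε` for which no nontrivial solution of `(H_ω - E) φ = 0` is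
square-summable at `ε ∞`. -/
def stabilitySet (α lam : ℝ) (S : Set ℝ) : Set (hull α) :=
  {ω | ∀ E ∈ S,
    (∀ φ : ℤ → ℂ, φ ≠ 0 → IsSolution (potential lam ω.1) E φ → ¬ SqSummableAtTop φ) ∨
    (∀ φ : ℤ → ℂ, φ ≠ 0 → IsSolution (potential lam ω.1) E φ → ¬ SqSummableAtBot φ)}

/-- A set has positive measure if it contains a measurable set of positive measure. -/
def HasPositiveMeasure {X : Type*} [MeasurableSpace X] (μ : Measure X) (A : Set X) : Prop :=
  ∃ B : Set X, B ⊆ A ∧ MeasurableSet B ∧ 0 < μ B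

end Sturmian

end

/-!
# Stability sets of Sturmian Schrödinger operators have positive measure

The elements of the hull that matter are the codings `code α θ` of the rotation by `α`, with
`code α 0 = word α`. The measure of the hull is the image of Lebesgue measure on the circle under
`θ ↦ code α θ`. Words have frequencies because the numbers of visits up to time `n` from two
starting points differ by `o(n)`, uniformly (`exists_abs_visits_sub_le`), so that each of them is
close to the average over the circle. The hull is minimal, and the spectrum of a Schrödinger
operator is determined by finite pieces of its potential through finitely supported approximate
eigenvectors; hence all `H_ω` have the spectrum of `H_{v_α}` (`spectrum_eq_of_mem_hull`).

For the stability set the sign can always be `+`. Let `q_n` be the denominators of the convergents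
of `α`. The transfer matrices over the prefixes of length `q_n` of the Sturmian word satisfy
`M_{n+2} = M_n M_{n+1}^{a_n}` (`blockMat_eq_transfer`). Their traces obey the trace map, for which
there is an open escape condition after which all traces exceed `2` in modulus (`Escapes.two_lt`).
The periodic approximants of period `q_k` have no spectrum where their trace exceeds `2` in modulus
(`abs_trace_le_of_periodic`), so energies in the spectrum never escape
(`not_escapes_of_mem_spectrum`); the invariant of the trace map then bounds their traces by
`5 + lam ^ 2` (`abs_blockTrace_le`).

If `ω` carries on `1, …, 2 q_n` the square of a cyclic permutation of the prefix of length `q_n`,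
then the Cayley–Hamilton theorem bounds `(φ(1), φ(0))` by the values of a solution `φ` near `q_n`
and `2 q_n`, up to a factor depending on the trace only. If this happens for infinitely many `n`,
no solution decays at `+∞` (`not_sqSummable_of_frequently_square`). Along the orbit of a point that
is close to `0` on the appropriate side such squares are visible (`code_block`). They occupy at
scale `q_{n+1}` a set of measure at least `q_{n+1} (gap n - gap (n + 1))`, where
`gap n = |q_n α - p_n|`, and this is at least `1 / 8` for infinitely many `n`. So the upper limit
of these sets has measure at least `1 / 8`.
-/

namespace Sturmian

/-! ### Continued fraction expansion of the rotation number -/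

/-- The distances `|q_n α - p_n|` produced by the Euclidean algorithm applied to `(1, α)`. -/
noncomputable def gap (α : ℝ) : ℕ → ℝ
  | 0 => 1
  | 1 => α
  | n + 2 => gap α n - ⌊gap α n / gap α (n + 1)⌋₊ * gap α (n + 1)

/-- The partial quotients of `α`; `digit α 0` is `⌊1 / α⌋`. -/
noncomputable def digit (α : ℝ) (n : ℕ) : ℕ := ⌊gap α n / gap α (n + 1)⌋₊

/-- The denominators `q_n` of the convergents of `α`, numbered so that `q_0 = 0` and `q_1 = 1`. -/
noncomputable def den (α : ℝ) : ℕ → ℕ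
  | 0 => 0
  | 1 => 1
  | n + 2 => digit α n * den α (n + 1) + den α n

/-- The numerators `p_n` of the convergents of `α`, numbered so that `p_0 = 1` and `p_1 = 0`. -/
noncomputable def num (α : ℝ) : ℕ → ℤ
  | 0 => 1
  | 1 => 0
  | n + 2 => digit α n * num α (n + 1) + num α n

lemma gap_add_two (α : ℝ) (n : ℕ) :
    gap α (n + 2) = gap α n - digit α n * gap α (n + 1) := rfl

lemma den_add_two (α : ℝ) (n : ℕ) :
    den α (n + 2) = digit α n * den α (n + 1) + den α n := rfl

lemma num_add_two (α : ℝ) (n : ℕ) :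
    num α (n + 2) = digit α n * num α (n + 1) + num α n := rfl

lemma den_mul_sub_num (α : ℝ) (n : ℕ) :
    den α n * α - num α n = (-1) ^ (n + 1) * gap α n := by
  induction n using Nat.twoStepInduction with
  | zero => simp [den, num, gap]
  | one => simp [den, num, gap]
  | more n h0 h1 =>
    rw [den_add_two, num_add_two, gap_add_two]
    push_cast
    rw [pow_succ] at h1 ⊢
    rw [pow_succ]
    linear_combination h0 + (digit α n : ℝ) * h1

lemma num_den_det (α : ℝ) (n : ℕ) :
    (den α (n + 1) : ℤ) * num α n - num α (n + 1) * den α n = (-1) ^ n := by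
  induction n with
  | zero => simp [den, num]
  | succ n ih =>
    rw [den_add_two, num_add_two, pow_succ]
    push_cast
    linear_combination -ih

lemma den_mul_gap (α : ℝ) (n : ℕ) :
    den α (n + 1) * gap α n + den α n * gap α (n + 1) = 1 := by
  induction n with
  | zero => simp [den, gap]
  | succ n ih =>
    rw [den_add_two, gap_add_two]
    push_cast
    linear_combination ih

section

variable {α : ℝ} (hα : Irrational α) (hα0 : 0 < α) (hα1 : α < 1)

include hα in
lemma mul_sub_ne_zero {i : ℤ} (hi : i ≠ 0) (m : ℤ) : (i : ℝ) * α - m ≠ 0 := by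
  intro h
  exact (hα.intCast_mul hi).ne_int m (by linarith)

include hα hα0 hα1 in
lemma gap_pos_and_lt (n : ℕ) :
    0 < gap α (n + 1) ∧ gap α (n + 1) < gap α n ∧ 0 < den α (n + 1) := by
  induction n with
  | zero => simp [gap, den, hα0, hα1]
  | succ n ih =>
    obtain ⟨h1, h2, h3⟩ := ih
    have hd : 1 ≤ digit α n := by
      rw [digit, Nat.one_le_floor_iff, le_div_iff₀ h1]
      linarith
    have hden : 0 < den α (n + 2) := by
      rw [den_add_two]
      positivity
    have hle : (digit α n : ℝ) * gap α (n + 1) ≤ gap α n := by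
      rw [← le_div_iff₀ h1]
      exact Nat.floor_le (div_nonneg (h1.le.trans h2.le) h1.le)
    have hlt : gap α n < (digit α n + 1) * gap α (n + 1) := by
      rw [← div_lt_iff₀ h1]
      exact Nat.lt_floor_add_one _
    refine ⟨lt_of_le_of_ne ?_ ?_, ?_, hden⟩
    · rw [gap_add_two]
      linarith
    · intro h
      have h4 := den_mul_sub_num α (n + 2)
      rw [← h, mul_zero] at h4
      exact mul_sub_ne_zero hα (i := den α (n + 2)) (by exact_mod_cast hden.ne')
        (num α (n + 2)) (by exact_mod_cast h4)
    · rw [gap_add_two]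
      linarith

include hα hα0 hα1 in
lemma gap_pos (n : ℕ) : 0 < gap α n := by
  cases n with
  | zero => simp [gap]
  | succ n => exact (gap_pos_and_lt hα hα0 hα1 n).1

include hα hα0 hα1 in
lemma gap_succ_lt (n : ℕ) : gap α (n + 1) < gap α n := (gap_pos_and_lt hα hα0 hα1 n).2.1

include hα hα0 hα1 in
lemma den_pos (n : ℕ) : 0 < den α (n + 1) := (gap_pos_and_lt hα hα0 hα1 n).2.2

include hα hα0 hα1 in
lemma one_le_digit (n : ℕ) : 1 ≤ digit α n := by
  rw [digit, Nat.one_le_floor_iff, le_div_iff₀ (gap_pos hα hα0 hα1 _)]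
  linarith [gap_succ_lt hα hα0 hα1 n]

include hα hα0 hα1 in
lemma den_add_le (n : ℕ) : den α (n + 1) + den α n ≤ den α (n + 2) := by
  rw [den_add_two]
  nlinarith [one_le_digit hα hα0 hα1 n, den_pos hα hα0 hα1 n]

include hα hα0 hα1 in
lemma den_le_succ (n : ℕ) : den α n ≤ den α (n + 1) := by
  cases n with
  | zero => simp [den]
  | succ n => exact (Nat.le_add_right _ _).trans (den_add_le hα hα0 hα1 n)

include hα hα0 hα1 in
lemma le_den_add_two (n : ℕ) : n + 1 ≤ den α (n + 2) := by
  induction n with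
  | zero => exact den_pos hα hα0 hα1 1
  | succ n ih =>
    have := den_add_le hα hα0 hα1 (n + 1)
    have := den_pos hα hα0 hα1 n
    simp only [Nat.add_assoc] at *
    norm_num at *
    omega

include hα hα0 hα1 in
lemma tendsto_den : Tendsto (den α) atTop atTop := by
  rw [← tendsto_add_atTop_iff_nat 2]
  exact tendsto_atTop_mono (fun n => (Nat.le_succ n).trans (le_den_add_two hα hα0 hα1 n))
    tendsto_id

include hα hα0 hα1 in
lemma tendsto_gap : Tendsto (gap α) atTop (𝓝 0) := by
  have h : ∀ n, gap α n ≤ 1 / (den α (n + 1) : ℝ) := fun n => by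
    have h1 : (0 : ℝ) < den α (n + 1) := by exact_mod_cast den_pos hα hα0 hα1 n
    rw [le_div_iff₀ h1]
    nlinarith [den_mul_gap α n, gap_pos hα hα0 hα1 (n + 1), Nat.cast_nonneg (α := ℝ) (den α n)]
  refine squeeze_zero (fun n => (gap_pos hα hα0 hα1 n).le) h ?_
  simp only [one_div]
  exact tendsto_inv_atTop_zero.comp (tendsto_natCast_atTop_atTop.comp
    ((tendsto_den hα hα0 hα1).comp (tendsto_add_atTop_nat 1)))

include hα hα0 hα1 in
/-- Convergents are best approximations of the second kind. The vectors `(q_n, p_n)` and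
`(q_{n+1}, p_{n+1})` form a basis of `ℤ²`, and in the expansion of `(i, m)` with `0 < i < q_{n+1}`
the two contributions to `i α - m` have the same sign. -/
lemma gap_le_abs (n : ℕ) {i : ℤ} (hi : 0 < i) (hi' : i < den α (n + 1)) (m : ℤ) :
    gap α n ≤ |(i : ℝ) * α - m| := by
  obtain ⟨u, w, hu, hw⟩ : ∃ u w : ℤ, i = u * den α n + w * den α (n + 1) ∧
      m = u * num α n + w * num α (n + 1) := by
    have hdet := num_den_det α n
    have hs : ((-1 : ℤ) ^ n) * (-1) ^ n = 1 := by rw [← mul_pow]; simp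
    refine ⟨(-1) ^ n * (den α (n + 1) * m - num α (n + 1) * i),
      (-1) ^ n * (num α n * i - den α n * m), ?_, ?_⟩
    · linear_combination (-i) * hs - i * (-1) ^ n * hdet
    · linear_combination (-m) * hs - m * (-1) ^ n * hdet
  have hg0 := gap_pos hα hα0 hα1 n
  have hg1 := gap_pos hα hα0 hα1 (n + 1)
  have hq1 : (0 : ℤ) < den α (n + 1) := by exact_mod_cast den_pos hα hα0 hα1 n
  have hq0 : (0 : ℤ) ≤ den α n := by positivity
  have key : (i : ℝ) * α - m = (-1) ^ (n + 1) * (u * gap α n - w * gap α (n + 1)) := by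
    have h0 := den_mul_sub_num α n
    have h1 := den_mul_sub_num α (n + 1)
    rw [pow_succ] at h1
    rw [hu, hw]
    push_cast
    linear_combination (u : ℝ) * h0 + (w : ℝ) * h1
  rw [key, abs_mul, abs_pow, abs_neg, abs_one, one_pow, one_mul]
  rcases lt_trichotomy w 0 with hw0 | hw0 | hw0
  · have hu1 : 1 ≤ u := by
      by_contra! h
      nlinarith
    have hu1' : (1 : ℝ) ≤ u := by exact_mod_cast hu1
    have hw0' : (w : ℝ) < 0 := by exact_mod_cast hw0
    refine le_trans ?_ (le_abs_self _)
    nlinarith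
  · subst hw0
    have hu0 : u ≠ 0 := by
      rintro rfl
      simp at hu
      omega
    have : (1 : ℝ) ≤ |(u : ℝ)| := by exact_mod_cast Int.one_le_abs hu0
    rw [Int.cast_zero, zero_mul, sub_zero, abs_mul, abs_of_pos hg0]
    nlinarith
  · have hu1 : u ≤ -1 := by
      by_contra! h
      have h0 : 0 ≤ u := by omega
      nlinarith
    have hu1' : (u : ℝ) ≤ -1 := by exact_mod_cast hu1
    have hw0' : (0 : ℝ) < w := by exact_mod_cast hw0
    refine le_trans ?_ (neg_le_abs _)
    nlinarith

include hα hα0 hα1 in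
lemma gap_le_abs' (n : ℕ) {i : ℤ} (hi : i ≠ 0) (hi' : |i| < den α (n + 1)) (m : ℤ) :
    gap α n ≤ |(i : ℝ) * α - m| := by
  rcases lt_or_gt_of_ne hi with h | h
  · have := gap_le_abs hα hα0 hα1 n (i := -i) (by omega) (by rwa [abs_of_neg h] at hi') (-m)
    rw [← abs_neg]
    convert this using 2
    push_cast
    ring
  · exact gap_le_abs hα hα0 hα1 n h (by rwa [abs_of_pos h] at hi') m

end

/-! ### Codings of rotations -/

/-- The coding of the orbit of `θ` under the rotation by `α` with respect to the interval
`[1 - α, 1)` of the circle: `code α θ n = χ_{[1 - α, 1)}(n α + θ mod 1)`, expressed by increments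
of the integer part. -/
noncomputable def code (α θ : ℝ) : Seq := fun n =>
  if ⌊((n + 1 : ℤ) : ℝ) * α + θ⌋ = ⌊(n : ℝ) * α + θ⌋ then 0 else 1

lemma word_eq_code {α : ℝ} (hα0 : 0 < α) : word α = code α 0 := by
  funext n
  have h0 := Int.fract_nonneg ((n : ℝ) * α)
  have h1 := Int.fract_lt_one ((n : ℝ) * α)
  have h2 := Int.floor_add_fract ((n : ℝ) * α)
  simp only [word, code, Set.mem_Ico, h1, and_true, add_zero]
  have h3 : (⌊((n + 1 : ℤ) : ℝ) * α⌋ = ⌊(n : ℝ) * α⌋) ↔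
      ¬ (1 - α ≤ Int.fract ((n : ℝ) * α)) := by
    rw [Int.floor_eq_iff]
    push_cast
    constructor
    · rintro ⟨_, h⟩
      linarith
    · intro h
      constructor <;> linarith
  by_cases h : 1 - α ≤ Int.fract ((n : ℝ) * α)
  · rw [if_pos h, if_neg (by rw [h3]; exact not_not.2 h)]
  · rw [if_neg h, if_pos (h3.2 h)]

/-- Equality of two codings at a place where the integer parts agree up to a constant. -/
lemma code_eq_of_floor {α θ θ' : ℝ} {m n c : ℤ}
    (h0 : ⌊(m : ℝ) * α + θ'⌋ = ⌊(n : ℝ) * α + θ⌋ + c)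
    (h1 : ⌊((m + 1 : ℤ) : ℝ) * α + θ'⌋ = ⌊((n + 1 : ℤ) : ℝ) * α + θ⌋ + c) :
    code α θ' m = code α θ n := by
  simp only [code]
  rw [h0, h1]
  simp

lemma code_add_int (α θ : ℝ) (k m n : ℤ) : code α (θ + k * α + m) n = code α θ (n + k) := by
  apply code_eq_of_floor (c := m)
  · rw [← Int.floor_add_intCast]
    congr 1
    push_cast
    ring
  · rw [← Int.floor_add_intCast]
    congr 1
    push_cast
    ring

lemma shift_iterate (τ : Seq) (k : ℕ) (n : ℤ) : shift^[k] τ n = τ (n + k) := by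
  induction k generalizing τ with
  | zero => simp
  | succ k ih =>
    rw [Function.iterate_succ_apply, ih, shift]
    congr 1
    push_cast
    ring

/-- Integer parts are unchanged by a displacement of `x` by `d` if no integer is crossed. -/
lemma floor_add_eq_of_gap {x d : ℝ} (h : ∀ m : ℤ, (m : ℝ) ≤ x ↔ (m : ℝ) ≤ x + d) :
    ⌊x + d⌋ = ⌊x⌋ :=
  le_antisymm (Int.le_floor.2 ((h _).2 (Int.floor_le _)))
    (Int.le_floor.2 ((h _).1 (Int.floor_le _)))

section

variable {α : ℝ} (hα : Irrational α) (hα0 : 0 < α) (hα1 : α < 1)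

include hα hα0 hα1 in
lemma floor_add_den_mul (n : ℕ) {i : ℤ} (hi : 0 < i) (hi' : i < den α (n + 1)) :
    ⌊((i + den α n : ℤ) : ℝ) * α⌋ = ⌊(i : ℝ) * α⌋ + num α n := by
  have hd := den_mul_sub_num α n
  have hg := gap_pos hα hα0 hα1 n
  have h1 : ((i + den α n : ℤ) : ℝ) * α = ((i : ℝ) * α + (den α n * α - num α n)) + num α n := by
    push_cast
    ring
  rw [h1, Int.floor_add_intCast, add_left_inj]
  apply floor_add_eq_of_gap
  intro m
  have hb := gap_le_abs hα hα0 hα1 n hi hi' m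
  have hne : ((i + den α n : ℤ) : ℝ) * α - ((m + num α n : ℤ) : ℝ) ≠ 0 :=
    mul_sub_ne_zero hα (by positivity) _
  push_cast at hne
  have h2 : den α n * α - num α n = gap α n ∨ den α n * α - num α n = - gap α n := by
    rw [hd]
    rcases neg_one_pow_eq_or ℝ (n + 1) with h | h <;> simp [h]
  constructor
  · intro h
    rw [abs_of_nonneg (by linarith)] at hb
    rcases h2 with h2 | h2 <;> linarith
  · intro h
    by_contra! h'
    rw [abs_of_neg (by linarith)] at hb
    apply hne
    rcases h2 with h2 | h2 <;> linarith

include hα hα0 hα1 in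
/-- The beginning of the Sturmian word, up to the position `q_{n+1} + q_n - 2`, has
period `q_n`. -/
lemma word_add_den (n : ℕ) {j : ℤ} (hj : 1 ≤ j) (hj' : j + 2 ≤ den α (n + 1)) :
    word α (j + den α n) = word α j := by
  rw [word_eq_code hα0]
  apply code_eq_of_floor (c := num α n)
  · rw [add_zero, add_zero]
    exact floor_add_den_mul hα hα0 hα1 n (by omega) (by omega)
  · rw [add_zero, add_zero, show j + (den α n : ℤ) + 1 = j + 1 + den α n by ring]
    exact floor_add_den_mul hα hα0 hα1 n (by omega) (by omega)

include hα hα0 hα1 in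
/-- Every half-line of the orbit of `x` visits every interval `[0, η)` of the circle, within a time
which does not depend on `x`: for a convergent with `0 < q α - p < η`, the points `x + j q α` move
around the circle by steps shorter than `η`. -/
lemma exists_bounded_return {η : ℝ} (hη : 0 < η) :
    ∃ L : ℕ, ∀ x : ℝ, ∃ k : ℕ, k ≤ L ∧ ∃ m : ℤ, 0 ≤ x + k * α - m ∧ x + k * α - m < η := by
  obtain ⟨n, hn, hodd⟩ : ∃ n, gap α n < η ∧ Even (n + 1) := by
    obtain ⟨N, hN⟩ := eventually_atTop.1 ((tendsto_gap hα hα0 hα1).eventually (gt_mem_nhds hη))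
    exact ⟨2 * N + 1, hN _ (by omega), ⟨N + 1, by ring⟩⟩
  have hd := den_mul_sub_num α n
  have hg := gap_pos hα hα0 hα1 n
  rw [hodd.neg_one_pow, one_mul] at hd
  refine ⟨⌈1 / gap α n⌉₊ * den α n, fun x => ?_⟩
  have hf0 := Int.fract_nonneg x
  have hf1 := Int.fract_lt_one x
  have hfl := Int.floor_add_fract x
  set j := ⌈(1 - Int.fract x) / gap α n⌉₊ with hj
  have hj1 : (1 - Int.fract x) / gap α n ≤ j := Nat.le_ceil _
  have hj2 : (j : ℝ) < (1 - Int.fract x) / gap α n + 1 :=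
    Nat.ceil_lt_add_one (div_nonneg (by linarith) hg.le)
  rw [div_le_iff₀ hg] at hj1
  have hj2' : j * gap α n < 1 - Int.fract x + gap α n := by
    have := mul_lt_mul_of_pos_right hj2 hg
    rwa [add_mul, div_mul_cancel₀ _ hg.ne', one_mul] at this
  refine ⟨j * den α n, Nat.mul_le_mul_right _ (Nat.ceil_mono ?_), ⌊x⌋ + 1 + j * num α n, ?_, ?_⟩
  · exact div_le_div_of_nonneg_right (by linarith) hg.le
  · push_cast
    have : x + j * den α n * α - (⌊x⌋ + 1 + j * num α n)
      = Int.fract x - 1 + j * (den α n * α - num α n) := by linear_combination -hfl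
    rw [this, hd]
    linarith
  · push_cast
    have : x + j * den α n * α - (⌊x⌋ + 1 + j * num α n)
      = Int.fract x - 1 + j * (den α n * α - num α n) := by linear_combination -hfl
    rw [this, hd]
    linarith

end

/-- Codings depend on the base point in a right-continuous way. -/
lemma exists_code_eq_right (α θ : ℝ) (N : ℕ) :
    ∃ η > 0, ∀ s, 0 ≤ s → s < η → ∀ j : ℤ, |j| ≤ N → code α (θ + s) j = code α θ j := by
  have key : ∀ N : ℕ, ∃ η > 0, ∀ s, 0 ≤ s → s < η → ∀ j : ℤ, |j| ≤ N →
      ⌊(j : ℝ) * α + (θ + s)⌋ = ⌊(j : ℝ) * α + θ⌋ := by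
    intro N
    have h1 : ∀ j : ℤ, ∃ η > 0, ∀ s, 0 ≤ s → s < η →
        ⌊(j : ℝ) * α + (θ + s)⌋ = ⌊(j : ℝ) * α + θ⌋ := fun j => by
      refine ⟨1 - Int.fract ((j : ℝ) * α + θ), by linarith [Int.fract_lt_one ((j : ℝ) * α + θ)],
        fun s hs hs' => ?_⟩
      have h2 := Int.floor_add_fract ((j : ℝ) * α + θ)
      have h3 := Int.fract_nonneg ((j : ℝ) * α + θ)
      rw [Int.floor_eq_iff]
      constructor <;> linarith
    choose η hη h using h1
    refine ⟨(Finset.Icc (-(N : ℤ)) N).inf' ⟨0, Finset.mem_Icc.2 ⟨by omega, by omega⟩⟩ η, ?_, ?_⟩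
    · exact (Finset.lt_inf'_iff _).2 fun j _ => hη j
    · intro s hs hs' j hj
      exact h j s hs ((Finset.lt_inf'_iff _).1 hs' j (Finset.mem_Icc.2 (abs_le.1 hj)))
  obtain ⟨η, hη, h⟩ := key (N + 1)
  refine ⟨η, hη, fun s hs hs' j hj => code_eq_of_floor (c := 0) ?_ ?_⟩
  · rw [add_zero]
    exact h s hs hs' j (by push_cast; omega)
  · rw [add_zero]
    refine h s hs hs' (j + 1) ?_
    rw [abs_le] at hj ⊢
    push_cast
    omega

/-- If `t` is close to `0` on the appropriate side, then the coding of `t` carries three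
consecutive copies of the first `q` letters of the coding of `0`, beginning at the position `1 - q`.
Here `q` is a denominator of a convergent, `d = q α - p`, and `η` is a lower bound for the distances
from `i α` to `ℤ` with `0 < |i| < q`: the points `t` and `t + d` have to lie within `η` of `0`, on
the right of `0` if `d > 0` and on the left of `0` if `d < 0`, so that none of the arcs from
`i α + t` to `i α + t + d` with `-q < i ≤ q + 1` crosses an integer. -/
lemma code_block {α : ℝ} {q : ℕ} {p : ℤ} {η d : ℝ}
    (hd : (q : ℝ) * α - p = d)
    (hbest : ∀ i : ℤ, i ≠ 0 → |i| < q → ∀ m : ℤ, η ≤ |(i : ℝ) * α - m|)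
    (h1 : α + 2 * η < 1) (h2 : 2 * η < α) {t : ℝ}
    (ht : (0 < d ∧ 0 ≤ t ∧ t + d < η) ∨ (d < 0 ∧ t < 0 ∧ -η ≤ t + d)) :
    (∀ j : ℤ, -q < j → j ≤ q → code α t (j + q) = code α t j) ∧
    (∀ j : ℤ, 1 ≤ j → j ≤ q → code α t j = code α 0 j) := by
  have hq' : ((q : ℤ) : ℝ) * α = p + d := by push_cast; linarith
  have A : ∀ i : ℤ, -q < i → i ≤ q + 1 → ⌊(i : ℝ) * α + t + d⌋ = ⌊(i : ℝ) * α + t⌋ := by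
    intro i hi hi'
    rcases eq_or_lt_of_le hi' with rfl | hi'
    · have : (((q : ℤ) + 1 : ℤ) : ℝ) * α = p + (α + d) := by push_cast at hq' ⊢; linarith
      rw [this, (Int.floor_eq_iff (z := p)).2, (Int.floor_eq_iff (z := p)).2]
      all_goals rcases ht with ⟨_, _, _⟩ | ⟨_, _, _⟩ <;> constructor <;> linarith
    rcases eq_or_lt_of_le (Int.lt_add_one_iff.1 hi') with rfl | hi'
    · rw [hq']
      rcases ht with ⟨_, _, _⟩ | ⟨_, _, _⟩
      · rw [(Int.floor_eq_iff (z := p)).2, (Int.floor_eq_iff (z := p)).2]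
        all_goals constructor <;> linarith
      · rw [(Int.floor_eq_iff (z := p - 1)).2, (Int.floor_eq_iff (z := p - 1)).2]
        all_goals push_cast; constructor <;> linarith
    rcases eq_or_ne i 0 with rfl | h0
    · rcases ht with ⟨_, _, _⟩ | ⟨_, _, _⟩
      · rw [(Int.floor_eq_iff (z := 0)).2, (Int.floor_eq_iff (z := 0)).2]
        all_goals push_cast; constructor <;> linarith
      · rw [(Int.floor_eq_iff (z := -1)).2, (Int.floor_eq_iff (z := -1)).2]
        all_goals push_cast; constructor <;> linarith
    · apply floor_add_eq_of_gap
      intro m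
      have hb := hbest i h0 (abs_lt.2 ⟨by omega, hi'⟩) m
      rcases ht with ⟨_, _, _⟩ | ⟨_, _, _⟩
      · refine ⟨fun h => by linarith, fun h => ?_⟩
        by_contra! h'
        rw [abs_of_neg (by linarith)] at hb
        linarith
      · refine ⟨fun h => ?_, fun h => by linarith⟩
        by_contra! h'
        rcases le_or_gt 0 ((i : ℝ) * α - m) with h3 | h3
        · rw [abs_of_nonneg h3] at hb
          linarith
        · linarith
  have B : ∀ i : ℤ, 1 ≤ i → i ≤ q + 1 → ⌊(i : ℝ) * α + t⌋ =
      ⌊(i : ℝ) * α + 0⌋ := by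
    intro i hi hi'
    rw [add_zero]
    rcases eq_or_lt_of_le hi' with rfl | hi'
    · have : (((q : ℤ) + 1 : ℤ) : ℝ) * α = p + (α + d) := by push_cast at hq' ⊢; linarith
      rw [this, (Int.floor_eq_iff (z := p)).2, (Int.floor_eq_iff (z := p)).2]
      all_goals rcases ht with ⟨_, _, _⟩ | ⟨_, _, _⟩ <;> constructor <;> linarith
    rcases eq_or_lt_of_le (Int.lt_add_one_iff.1 hi') with rfl | hi'
    · rw [hq']
      rcases ht with ⟨_, _, _⟩ | ⟨_, _, _⟩
      · rw [(Int.floor_eq_iff (z := p)).2, (Int.floor_eq_iff (z := p)).2]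
        all_goals constructor <;> linarith
      · rw [(Int.floor_eq_iff (z := p - 1)).2, (Int.floor_eq_iff (z := p - 1)).2]
        all_goals push_cast; constructor <;> linarith
    · apply floor_add_eq_of_gap
      intro m
      have hb := hbest i (by omega) (abs_lt.2 ⟨by omega, hi'⟩) m
      rcases ht with ⟨_, _, _⟩ | ⟨_, _, _⟩
      · refine ⟨fun h => by linarith, fun h => ?_⟩
        by_contra! h'
        rw [abs_of_neg (by linarith)] at hb
        linarith
      · refine ⟨fun h => ?_, fun h => by linarith⟩
        by_contra! h'
        rcases le_or_gt 0 ((i : ℝ) * α - m) with h3 | h3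
        · rw [abs_of_nonneg h3] at hb
          linarith
        · linarith
  have A' : ∀ i : ℤ, -q < i → i ≤ q + 1 →
      ⌊((i + q : ℤ) : ℝ) * α + t⌋ = ⌊(i : ℝ) * α + t⌋ + p := by
    intro i hi hi'
    rw [← A i hi hi', ← Int.floor_add_intCast]
    congr 1
    push_cast at hq' ⊢
    linarith
  refine ⟨fun j hj hj' => code_eq_of_floor (c := p) (A' j hj (by omega)) ?_,
    fun j hj hj' => code_eq_of_floor (c := 0) ?_ ?_⟩
  · rw [show j + (q : ℤ) + 1 = j + 1 + q by ring]
    exact A' (j + 1) (by omega) (by omega)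
  · rw [B j hj (by omega), add_zero, add_zero]
  · rw [B (j + 1) (by omega) (by omega), add_zero, add_zero]

/-! ### Transfer matrices -/

/-- The one-step transfer matrix: it maps `(φ(n), φ(n - 1))` to `(φ(n + 1), φ(n))` for a solution
`φ` at energy `E` of the equation whose potential has the value `v` at `n`. -/
def step (E v : ℝ) : Matrix (Fin 2) (Fin 2) ℝ := !![E - v, -1; 1, 0]

/-- The transfer matrix of the potential `V` over the `m` sites `n, n + 1, …, n + m - 1`. -/
def transfer (V : ℤ → ℝ) (E : ℝ) (n : ℤ) : ℕ → Matrix (Fin 2) (Fin 2) ℝ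
  | 0 => 1
  | m + 1 => step E (V (n + m)) * transfer V E n m

lemma det_step (E v : ℝ) : (step E v).det = 1 := by simp [step, Matrix.det_fin_two]

lemma det_transfer (V : ℤ → ℝ) (E : ℝ) (n : ℤ) (m : ℕ) : (transfer V E n m).det = 1 := by
  induction m with
  | zero => simp [transfer]
  | succ m ih => rw [transfer, Matrix.det_mul, det_step, ih, one_mul]

lemma transfer_add (V : ℤ → ℝ) (E : ℝ) (n : ℤ) (m k : ℕ) :
    transfer V E n (m + k) = transfer V E (n + m) k * transfer V E n m := by
  induction k with
  | zero => simp [transfer]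
  | succ k ih =>
    rw [← add_assoc, transfer, transfer, ih, Matrix.mul_assoc, Nat.cast_add, add_assoc]

lemma transfer_congr {V W : ℤ → ℝ} (E : ℝ) {n n' : ℤ} {m : ℕ}
    (h : ∀ j : ℕ, j < m → V (n + j) = W (n' + j)) : transfer V E n m = transfer W E n' m := by
  induction m with
  | zero => rfl
  | succ m ih => rw [transfer, transfer, ih fun j hj => h j (by omega), h m (by omega)]

lemma transfer_succ' (V : ℤ → ℝ) (E : ℝ) (n : ℤ) (m : ℕ) :
    transfer V E n (m + 1) = transfer V E (n + 1) m * step E (V n) := by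
  rw [add_comm m 1, transfer_add]
  simp [transfer]

lemma transfer_mul_of_periodic {V : ℤ → ℝ} (E : ℝ) {n : ℤ} {q a : ℕ}
    (h : ∀ k < a, ∀ j < q, V (n + (k * q : ℕ) + (j : ℕ)) = V (n + (j : ℕ))) :
    transfer V E n (a * q) = transfer V E n q ^ a := by
  induction a with
  | zero => simp [transfer]
  | succ a ih =>
    rw [Nat.succ_mul, transfer_add, ih fun k hk => h k (by omega), pow_succ']
    congr 1
    exact transfer_congr E fun j hj => h a (by omega) j hj

/-- The trace of the transfer matrix over a period does not depend on the starting point. -/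
lemma trace_transfer_succ {V : ℤ → ℝ} (E : ℝ) {n : ℤ} {q : ℕ} (h : V (n + q) = V n) :
    (transfer V E (n + 1) q).trace = (transfer V E n q).trace := by
  have h1 : transfer V E (n + 1) q * step E (V n) = step E (V n) * transfer V E n q := by
    rw [← transfer_succ', transfer, h]
  have h2 : IsUnit (step E (V n)).det := by rw [det_step]; exact isUnit_one
  have h3 : transfer V E (n + 1) q = step E (V n) * transfer V E n q * (step E (V n))⁻¹ := by
    rw [← h1, Matrix.mul_nonsing_inv_cancel_right _ _ h2]
  rw [h3, Matrix.trace_mul_comm, Matrix.nonsing_inv_mul_cancel_left _ _ h2]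

lemma trace_transfer_of_periodic {V : ℤ → ℝ} (E : ℝ) {q : ℕ} (h : ∀ n, V (n + q) = V n) (n n' : ℤ) :
    (transfer V E n q).trace = (transfer V E n' q).trace := by
  have key : ∀ (k : ℕ) (n : ℤ), (transfer V E (n + k) q).trace = (transfer V E n q).trace := by
    intro k n
    induction k with
    | zero => simp
    | succ k ih => rw [← ih, Nat.cast_succ, ← add_assoc, trace_transfer_succ E (h _)]
  rcases le_total n n' with hn | hn
  · obtain ⟨k, rfl⟩ := Int.le.dest hn
    exact (key k n).symm
  · obtain ⟨k, rfl⟩ := Int.le.dest hn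
    exact key k n'

/-- The value of `(H - E) u` at `n`. -/
def defect (V : ℤ → ℝ) (E : ℝ) (u : ℤ → ℂ) (n : ℤ) : ℂ :=
  u (n + 1) + u (n - 1) + (V n : ℂ) * u n - (E : ℂ) * u n

/-- Transfer matrices for the inhomogeneous equation: the error is controlled by the defect on the
sites passed. -/
lemma exists_transfer_bound {V : ℤ → ℝ} {C : ℝ} (hV : ∀ n, |V n| ≤ C) (E : ℝ) (m : ℕ) :
    ∃ K : ℝ, 0 ≤ K ∧ ∀ (u : ℤ → ℂ) (n : ℤ),
      ‖u (n + m) - ((transfer V E n m 0 0 : ℂ) * u n + (transfer V E n m 0 1 : ℂ) * u (n - 1))‖ ≤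
        K * ∑ j ∈ Finset.range m, ‖defect V E u (n + j)‖ ∧
      ‖u (n + m - 1) -
          ((transfer V E n m 1 0 : ℂ) * u n + (transfer V E n m 1 1 : ℂ) * u (n - 1))‖ ≤
        K * ∑ j ∈ Finset.range m, ‖defect V E u (n + j)‖ := by
  induction m with
  | zero => exact ⟨0, le_rfl, fun u n => by simp [transfer]⟩
  | succ m ih =>
    obtain ⟨K, hK, h⟩ := ih
    have hC : 0 ≤ C := (abs_nonneg _).trans (hV 0)
    refine ⟨(|E| + C + 1) * K + 1, by positivity, fun u n => ?_⟩
    obtain ⟨h0, h1⟩ := h u n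
    set S := ∑ j ∈ Finset.range m, ‖defect V E u (n + j)‖ with hS
    have hS0 : 0 ≤ S := Finset.sum_nonneg fun _ _ => norm_nonneg _
    set f := defect V E u (n + m) with hf
    set e0 := u (n + m) - ((transfer V E n m 0 0 : ℂ) * u n +
      (transfer V E n m 0 1 : ℂ) * u (n - 1)) with he0
    set e1 := u (n + m - 1) - ((transfer V E n m 1 0 : ℂ) * u n +
      (transfer V E n m 1 1 : ℂ) * u (n - 1)) with he1
    rw [Finset.sum_range_succ, ← hS, ← hf]
    have hEV : ‖((E - V (n + m) : ℝ) : ℂ)‖ ≤ |E| + C := by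
      rw [Complex.norm_real, Real.norm_eq_abs]
      exact (abs_sub _ _).trans (by linarith [hV (n + m)])
    have hcast : (n + ((m + 1 : ℕ) : ℤ)) = n + m + 1 := by push_cast; ring
    have hKS : 0 ≤ K * S := mul_nonneg hK hS0
    have hEC : 0 ≤ |E| + C := add_nonneg (abs_nonneg _) hC
    constructor
    · have : u (n + ((m + 1 : ℕ) : ℤ)) - ((transfer V E n (m + 1) 0 0 : ℂ) * u n +
          (transfer V E n (m + 1) 0 1 : ℂ) * u (n - 1)) =
          ((E - V (n + m) : ℝ) : ℂ) * e0 - e1 + f := by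
        rw [hcast, hf, defect, he0, he1, transfer]
        simp only [step, Matrix.mul_apply, Fin.sum_univ_two, Matrix.of_apply, Matrix.cons_val_zero,
          Matrix.cons_val_one, Matrix.cons_val', Matrix.cons_val_fin_one]
        push_cast
        ring
      rw [this]
      refine (norm_add_le _ _).trans ?_
      have h2 := norm_sub_le (((E - V (n + m) : ℝ) : ℂ) * e0) e1
      rw [norm_mul] at h2
      have h3 : ‖((E - V (n + m) : ℝ) : ℂ)‖ * ‖e0‖ ≤ (|E| + C) * (K * S) :=
        mul_le_mul hEV h0 (norm_nonneg _) hEC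
      have h4 : 0 ≤ ((|E| + C + 1) * K) * ‖f‖ := by positivity
      nlinarith [norm_nonneg f]
    · have : u (n + ((m + 1 : ℕ) : ℤ) - 1) - ((transfer V E n (m + 1) 1 0 : ℂ) * u n +
          (transfer V E n (m + 1) 1 1 : ℂ) * u (n - 1)) = e0 := by
        rw [hcast, add_sub_cancel_right, he0, transfer]
        simp [step, Matrix.mul_apply, Fin.sum_univ_two]
      rw [this]
      have h4 : 0 ≤ ((|E| + C + 1) * K + 1) * ‖f‖ := by positivity
      have h5 : 0 ≤ (|E| + C) * (K * S) := mul_nonneg hEC hKS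
      nlinarith [norm_nonneg f]

/-- Across two copies of a block of length `q` the Cayley–Hamilton theorem for the transfer matrix
of the block gives a three-term recurrence with the trace as coefficient, up to an error controlled
by the defect. -/
lemma exists_recurrence_bound {V : ℤ → ℝ} {C : ℝ} (hV : ∀ n, |V n| ≤ C) (E : ℝ) (q : ℕ) :
    ∃ K : ℝ, 0 ≤ K ∧ ∀ (u : ℤ → ℂ) (n : ℤ), (∀ j : ℕ, j < q → V (n + q + j) = V (n + j)) →
      ‖u (n + (2 * q : ℕ)) - ((transfer V E n q).trace : ℂ) * u (n + q) + u n‖ ≤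
        K * ∑ j ∈ Finset.range (2 * q), ‖defect V E u (n + j)‖ ∧
      ‖u (n + (2 * q : ℕ) - 1) - ((transfer V E n q).trace : ℂ) * u (n + q - 1) + u (n - 1)‖ ≤
        K * ∑ j ∈ Finset.range (2 * q), ‖defect V E u (n + j)‖ := by
  obtain ⟨K, hK, h⟩ := exists_transfer_bound hV E q
  obtain ⟨K', hK', h'⟩ := exists_transfer_bound hV E (2 * q)
  -- the trace is bounded uniformly in the base point
  obtain ⟨R, hR⟩ : ∃ R, ∀ n, ‖((transfer V E n q).trace : ℂ)‖ ≤ R := by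
    have key : ∀ m : ℕ, ∃ R, ∀ n i j, |transfer V E n m i j| ≤ R := by
      intro m
      induction m with
      | zero =>
        refine ⟨1, fun n i j => ?_⟩
        fin_cases i <;> fin_cases j <;> simp [transfer]
      | succ m ih =>
        obtain ⟨R, hR⟩ := ih
        refine ⟨(|E| + C) * R + R, fun n i j => ?_⟩
        have hR0 : 0 ≤ R := (abs_nonneg _).trans (hR 0 0 0)
        have hEC : 0 ≤ |E| + C := add_nonneg (abs_nonneg _) ((abs_nonneg _).trans (hV 0))
        have hEV : |E - V (n + m)| ≤ |E| + C := (abs_sub _ _).trans (by linarith [hV (n + m)])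
        have h1 : |E - V (n + m)| * |transfer V E n m 0 j| ≤ (|E| + C) * R :=
          mul_le_mul hEV (hR _ _ _) (abs_nonneg _) hEC
        have h2 : 0 ≤ (|E| + C) * R := mul_nonneg hEC hR0
        fin_cases i
        · simp only [transfer, step, Matrix.mul_apply, Fin.sum_univ_two, Matrix.of_apply,
            Matrix.cons_val_zero, Matrix.cons_val_one, Matrix.cons_val', Matrix.cons_val_fin_one,
            Fin.zero_eta]
          refine (abs_add_le _ _).trans ?_
          rw [abs_mul, abs_mul, abs_neg, abs_one, one_mul]
          linarith [hR n 1 j]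
        · simp only [transfer, step, Matrix.mul_apply, Fin.sum_univ_two, Matrix.of_apply,
            Matrix.cons_val_zero, Matrix.cons_val_one, Matrix.cons_val', Matrix.cons_val_fin_one,
            Fin.mk_one]
          rw [one_mul, zero_mul, add_zero]
          linarith [hR n 0 j]
    obtain ⟨R, hR⟩ := key q
    refine ⟨R + R, fun n => ?_⟩
    rw [Complex.norm_real, Real.norm_eq_abs, Matrix.trace_fin_two]
    exact (abs_add_le _ _).trans (add_le_add (hR _ _ _) (hR _ _ _))
  have hR0 : 0 ≤ R := (norm_nonneg _).trans (hR 0)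
  refine ⟨K' + R * K, by positivity, fun u n hper => ?_⟩
  obtain ⟨h0, h1⟩ := h u n
  obtain ⟨h0', h1'⟩ := h' u n
  have hsq : transfer V E n (2 * q) = transfer V E n q * transfer V E n q := by
    rw [two_mul, transfer_add]
    congr 1
    exact transfer_congr E hper
  have hdet := det_transfer V E n q
  rw [Matrix.det_fin_two] at hdet
  have hdet' : (transfer V E n q 0 0 : ℂ) * transfer V E n q 1 1 -
      transfer V E n q 0 1 * transfer V E n q 1 0 = 1 := by exact_mod_cast hdet
  set M := transfer V E n q with hM
  have hsum : ∑ j ∈ Finset.range q, ‖defect V E u (n + j)‖ ≤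
      ∑ j ∈ Finset.range (2 * q), ‖defect V E u (n + j)‖ :=
    Finset.sum_le_sum_of_subset_of_nonneg (Finset.range_mono (by omega))
      fun _ _ _ => norm_nonneg _
  set S := ∑ j ∈ Finset.range q, ‖defect V E u (n + j)‖
  set S' := ∑ j ∈ Finset.range (2 * q), ‖defect V E u (n + j)‖
  have hKS : K * S ≤ K * S' := mul_le_mul_of_nonneg_left hsum hK
  have final : ∀ g e e' : ℂ, g = e' - (M.trace : ℂ) * e → ‖e‖ ≤ K * S → ‖e'‖ ≤ K' * S' →
      ‖g‖ ≤ (K' + R * K) * S' := by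
    rintro g e e' rfl he he'
    refine (norm_sub_le _ _).trans ?_
    rw [norm_mul]
    have := mul_le_mul (hR n) (he.trans hKS) (norm_nonneg _) hR0
    linarith
  rw [hsq] at h0' h1'
  simp only [Matrix.mul_apply, Fin.sum_univ_two] at h0' h1'
  refine ⟨final _ _ _ ?_ h0 h0', final _ _ _ ?_ h1 h1'⟩
  · rw [Matrix.trace_fin_two]
    push_cast
    linear_combination (-u n) * hdet'
  · rw [Matrix.trace_fin_two]
    push_cast
    linear_combination (-u (n - 1)) * hdet'

/-! ### The trace map -/

/-- Transfer matrices over the prefixes of length `q_n` of the Sturmian word (for `n ≥ 2`, see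
`blockMat_eq_transfer`), defined by the recursion `M_{n+2} = M_n M_{n+1}^{a_n}`. The recursion
starts with the parabolic matrix `step E lam * (step E 0)⁻¹`, which belongs to no word. -/
noncomputable def blockMat (α lam E : ℝ) : ℕ → Matrix (Fin 2) (Fin 2) ℝ
  | 0 => step E lam * !![0, 1; -1, E]
  | 1 => step E 0
  | n + 2 => blockMat α lam E n * blockMat α lam E (n + 1) ^ digit α n

/-- The trace of the transfer matrix over the prefix of length `q_n`. -/
noncomputable def blockTrace (α lam E : ℝ) (n : ℕ) : ℝ := (blockMat α lam E n).trace

/-- The trace of the product of two consecutive block matrices. -/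
noncomputable def pairTrace (α lam E : ℝ) (n : ℕ) : ℝ :=
  (blockMat α lam E n * blockMat α lam E (n + 1)).trace

lemma blockMat_add_two (α lam E : ℝ) (n : ℕ) :
    blockMat α lam E (n + 2) = blockMat α lam E n * blockMat α lam E (n + 1) ^ digit α n := rfl

lemma det_blockMat (α lam E : ℝ) (n : ℕ) : (blockMat α lam E n).det = 1 := by
  induction n using Nat.twoStepInduction with
  | zero => rw [blockMat, Matrix.det_mul, det_step, Matrix.det_fin_two]; simp
  | one => exact det_step E 0
  | more n h0 h1 => rw [blockMat_add_two, Matrix.det_mul, Matrix.det_pow, h0, h1]; simp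

lemma continuous_blockMat (α lam : ℝ) (n : ℕ) : Continuous fun E => blockMat α lam E n := by
  induction n using Nat.twoStepInduction with
  | zero =>
    refine Continuous.mul ?_ ?_
    all_goals
      refine continuous_matrix fun i j => ?_
      fin_cases i <;> fin_cases j <;> simp [step] <;> fun_prop
  | one =>
    refine continuous_matrix fun i j => ?_
    fin_cases i <;> fin_cases j <;> simp [blockMat, step] <;> fun_prop
  | more n h0 h1 => exact h0.mul (h1.pow _)

lemma trace_mul_pow_add_two {A : Matrix (Fin 2) (Fin 2) ℝ} (hA : A.det = 1)
    (B : Matrix (Fin 2) (Fin 2) ℝ) (k : ℕ) :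
    (B * A ^ (k + 2)).trace = A.trace * (B * A ^ (k + 1)).trace - (B * A ^ k).trace := by
  have h : A ^ 2 = A.trace • A - 1 := by
    rw [Matrix.det_fin_two] at hA
    rw [pow_two]
    ext i j
    fin_cases i <;> fin_cases j <;>
      simp [Matrix.mul_apply, Fin.sum_univ_two, Matrix.trace_fin_two] <;> linarith
  rw [pow_add, h, pow_succ, mul_sub, mul_one, mul_sub, Matrix.mul_smul, Matrix.mul_smul,
    Matrix.trace_sub, Matrix.trace_smul, smul_eq_mul]

section Recurrence

variable {x : ℝ} {t : ℕ → ℝ} (ht : ∀ k, t (k + 2) = x * t (k + 1) - t k)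

include ht in
lemma recurrence_invariant (k : ℕ) :
    x ^ 2 + t k ^ 2 + t (k + 1) ^ 2 - x * t k * t (k + 1) =
      x ^ 2 + t 0 ^ 2 + t 1 ^ 2 - x * t 0 * t 1 := by
  induction k with
  | zero => rfl
  | succ k ih =>
    rw [ht k, ← ih]
    ring

include ht in
lemma sub_le_abs_recurrence (k : ℕ) : |x| * |t (k + 1)| - |t k| ≤ |t (k + 2)| := by
  rw [ht, ← abs_mul]
  exact abs_sub_abs_le_abs_sub _ _

include ht in
/-- For a hyperbolic coefficient the recurrence keeps increasing in modulus from the first step on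
which it does not decrease. -/
lemma abs_recurrence_mono (hx : 2 < |x|) {m : ℕ} (hm : |t m| ≤ |t (m + 1)|) {k : ℕ} (hk : m ≤ k) :
    |t k| ≤ |t (k + 1)| := by
  induction k, hk using Nat.le_induction with
  | base => exact hm
  | succ k _ ih => nlinarith [sub_le_abs_recurrence ht k, abs_nonneg (t (k + 1))]

include ht in
lemma abs_lt_abs_recurrence (hx : 2 < |x|) {k : ℕ} (hk : |t k| ≤ |t (k + 1)|)
    (h2 : 2 < |t (k + 1)|) : |x| < |t (k + 2)| := by
  nlinarith [sub_le_abs_recurrence ht k]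

end Recurrence

/-- The traces `tr (M_n M_{n+1}^k)` interpolate between `blockTrace n` and `blockTrace (n + 2)`
by a linear recurrence with coefficient `blockTrace (n + 1)`. -/
lemma exists_interpolation (α lam E : ℝ) (n : ℕ) :
    ∃ t : ℕ → ℝ, (∀ k, t (k + 2) = blockTrace α lam E (n + 1) * t (k + 1) - t k) ∧
      t 0 = blockTrace α lam E n ∧ t 1 = pairTrace α lam E n ∧
      t (digit α n) = blockTrace α lam E (n + 2) ∧
      t (digit α n + 1) = pairTrace α lam E (n + 1) := by
  refine ⟨fun k => (blockMat α lam E n * blockMat α lam E (n + 1) ^ k).trace,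
    fun k => trace_mul_pow_add_two (det_blockMat _ _ _ _) _ _, ?_, ?_, rfl, ?_⟩
  · simp [blockTrace]
  · simp [pairTrace]
  · simp only [pairTrace, blockMat_add_two]
    rw [Matrix.trace_mul_comm (blockMat α lam E (n + 1)), pow_succ, Matrix.mul_assoc]

/-- The Fricke–Vogt invariant of the trace map. -/
lemma fricke_vogt (α lam E : ℝ) (n : ℕ) :
    blockTrace α lam E (n + 1) ^ 2 + blockTrace α lam E n ^ 2 + pairTrace α lam E n ^ 2 -
      blockTrace α lam E (n + 1) * blockTrace α lam E n * pairTrace α lam E n = 4 + lam ^ 2 := by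
  induction n with
  | zero =>
    have h0 : blockTrace α lam E 0 = 2 := by
      simp [blockTrace, blockMat, step, Matrix.trace_fin_two]
      norm_num
    have h1 : blockTrace α lam E 1 = E := by
      simp [blockTrace, blockMat, step, Matrix.trace_fin_two]
    have h2 : pairTrace α lam E 0 = E - lam := by
      simp [pairTrace, blockMat, step, Matrix.trace_fin_two]
    rw [h0, h1, h2]
    ring
  | succ n ih =>
    obtain ⟨t, ht, h0, h1, ha, ha'⟩ := exists_interpolation α lam E n
    have h := recurrence_invariant ht (digit α n)
    rw [h0, h1, ha, ha', ih] at h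
    linarith

/-- The escape condition: once it holds at a level, all later traces exceed `2` in modulus. -/
def Escapes (α lam E : ℝ) (n : ℕ) : Prop :=
  2 < |blockTrace α lam E (n + 1)| ∧ 2 < |pairTrace α lam E n| ∧
    |blockTrace α lam E n| < |pairTrace α lam E n|

lemma isOpen_escapes (α lam : ℝ) (n : ℕ) : IsOpen {E | Escapes α lam E n} := by
  have h1 : ∀ n, Continuous fun E => |blockTrace α lam E n| := fun n =>
    (continuous_blockMat α lam n).matrix_trace.abs
  have h2 : Continuous fun E => |pairTrace α lam E n| :=
    ((continuous_blockMat α lam n).mul (continuous_blockMat α lam (n + 1))).matrix_trace.abs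
  exact (isOpen_lt continuous_const (h1 _)).inter
    ((isOpen_lt continuous_const h2).inter (isOpen_lt (h1 _) h2))

section

variable {α : ℝ} (hα : Irrational α) (hα0 : 0 < α) (hα1 : α < 1) {lam E : ℝ}

include hα hα0 hα1 in
lemma Escapes.succ {n : ℕ} (h : Escapes α lam E n) : Escapes α lam E (n + 1) := by
  obtain ⟨t, ht, h0, h1, ha, ha'⟩ := exists_interpolation α lam E n
  obtain ⟨hx, hz, hlt⟩ := h
  obtain ⟨b, hb⟩ := Nat.exists_eq_add_of_le' (one_le_digit hα hα0 hα1 n)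
  rw [hb] at ha ha'
  rw [← h0, ← h1] at hlt
  rw [← h1] at hz
  have hmono : ∀ k, |t k| ≤ |t (k + 1)| := fun k =>
    abs_recurrence_mono ht hx (m := 0) hlt.le (Nat.zero_le k)
  have hb2 : 2 < |t (b + 1)| :=
    hz.trans_le (monotone_nat_of_le_succ (f := fun k => |t k|) hmono (Nat.le_add_left 1 b))
  have hlast := abs_lt_abs_recurrence ht hx (hmono b) hb2
  rw [Escapes, ← ha, ← ha']
  exact ⟨hb2, hx.trans hlast, hlast⟩

include hα hα0 hα1 in
lemma Escapes.two_lt {n k : ℕ} (h : Escapes α lam E n) (hk : n < k) :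
    2 < |blockTrace α lam E k| := by
  have : ∀ m, Escapes α lam E (n + m) := fun m => by
    induction m with
    | zero => exact h
    | succ m ih => exact ih.succ hα hα0 hα1
  obtain ⟨m, rfl⟩ := Nat.exists_eq_add_of_le hk
  rw [show n + 1 + m = n + m + 1 by ring]
  exact (this m).1

include hα hα0 hα1 in
lemma pairTrace_le_of_not_escapes (h : ∀ n, ¬ Escapes α lam E n) (n : ℕ)
    (hn : 2 < |blockTrace α lam E (n + 1)|) :
    |blockTrace α lam E n| ≤ 2 ∧ |pairTrace α lam E n| ≤ 2 := by
  have key : ∀ n, 2 < |blockTrace α lam E (n + 1)| → |blockTrace α lam E n| ≤ 2 →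
      |pairTrace α lam E n| ≤ 2 := fun n h1 h0 => by
    by_contra! h2
    exact h n ⟨h1, h2, h0.trans_lt h2⟩
  refine ⟨?_, key n hn ?_⟩ <;>
  · induction n with
    | zero =>
      simp [blockTrace, blockMat, step, Matrix.trace_fin_two]
      norm_num
    | succ n ih =>
      by_contra! hx
      have hx0 := ih hx
      have hz := key n hx hx0
      obtain ⟨t, ht, h0, h1, ha, ha'⟩ := exists_interpolation α lam E n
      -- the recurrence passes the value `2` in modulus at some step before `digit α n`
      obtain ⟨k, hk, hk1, hk2⟩ : ∃ k < digit α n, |t k| ≤ 2 ∧ 2 < |t (k + 1)| := by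
        by_contra! hcon
        have : ∀ k ≤ digit α n, |t k| ≤ 2 := by
          intro k
          induction k with
          | zero => intro _; rwa [h0]
          | succ k ihk => exact fun hk => hcon k (by omega) (ihk (by omega))
        have := this _ le_rfl
        rw [ha] at this
        linarith
      obtain ⟨b, hb⟩ := Nat.exists_eq_add_of_le' (one_le_digit hα hα0 hα1 n)
      rw [hb] at ha ha' hk
      have hmono := abs_recurrence_mono ht hx (hk1.trans hk2.le) (Nat.lt_succ_iff.1 hk)
      rw [← ha] at hn
      have hlast := abs_lt_abs_recurrence ht hx hmono hn
      refine h (n + 1) ⟨by rwa [← ha], ?_, ?_⟩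
      · rw [← ha']
        exact hx.trans hlast
      · rw [← ha']
        exact hlast

include hα hα0 hα1 in
/-- The traces of an energy that never escapes are bounded: a trace of modulus greater than `2` is
flanked by two traces of modulus at most `2`, and then the invariant bounds it. -/
lemma abs_blockTrace_le (h : ∀ n, ¬ Escapes α lam E n) (n : ℕ) :
    |blockTrace α lam E (n + 1)| ≤ 5 + lam ^ 2 := by
  by_contra! hn
  have h2 : 2 < |blockTrace α lam E (n + 1)| := by nlinarith [sq_nonneg lam]
  obtain ⟨hx, hz⟩ := pairTrace_le_of_not_escapes hα hα0 hα1 h n h2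
  have hI := fricke_vogt α lam E n
  have h3 : blockTrace α lam E (n + 1) * blockTrace α lam E n * pairTrace α lam E n ≤
      |blockTrace α lam E (n + 1)| * 4 := by
    refine (le_abs_self _).trans ?_
    rw [mul_assoc, abs_mul, abs_mul]
    refine mul_le_mul_of_nonneg_left ?_ (abs_nonneg _)
    nlinarith [abs_nonneg (blockTrace α lam E n), abs_nonneg (pairTrace α lam E n)]
  rw [← sq_abs (blockTrace α lam E (n + 1))] at hI
  nlinarith [sq_nonneg lam, sq_nonneg (blockTrace α lam E n), sq_nonneg (pairTrace α lam E n)]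

end

/-! ### Block structure of the Sturmian word -/

lemma transfer_of_const {V : ℤ → ℝ} (E : ℝ) {n : ℤ} {m : ℕ} {v : ℝ}
    (h : ∀ j : ℕ, j < m → V (n + j) = v) : transfer V E n m = step E v ^ m := by
  induction m with
  | zero => simp [transfer]
  | succ m ih => rw [transfer, ih fun j hj => h j (by omega), h m (by omega), pow_succ']

section

variable {α : ℝ} (hα : Irrational α) (hα0 : 0 < α) (hα1 : α < 1)

lemma den_two (α : ℝ) : den α 2 = digit α 0 := by simp [den]

include hα hα0 hα1 in
lemma word_of_lt_den_two {j : ℤ} (hj : 1 ≤ j) (hj' : j < den α 2) : word α j = 0 := by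
  have h := den_mul_sub_num α 2
  have hg := gap_pos hα hα0 hα1 2
  have hnum : num α 2 = 1 := by simp [num]
  rw [hnum] at h
  norm_num at h
  have h1 : ((j : ℝ) + 1) ≤ den α 2 := by exact_mod_cast hj'
  have h2 : (1 : ℝ) ≤ j := by exact_mod_cast hj
  have h3 : ((j : ℝ) + 1) * α ≤ den α 2 * α := mul_le_mul_of_nonneg_right h1 hα0.le
  rw [word_eq_code hα0, code, if_pos]
  rw [(Int.floor_eq_iff (z := 0)).2, (Int.floor_eq_iff (z := 0)).2]
  all_goals push_cast; constructor <;> nlinarith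

include hα hα0 hα1 in
lemma word_den_two : word α (den α 2) = 1 := by
  have h := den_mul_sub_num α 2
  have hg := gap_pos hα hα0 hα1 2
  have hg' : gap α 2 < α := gap_succ_lt hα hα0 hα1 1
  have hnum : num α 2 = 1 := by simp [num]
  rw [hnum] at h
  norm_num at h
  rw [word_eq_code hα0, code, if_neg]
  rw [(Int.floor_eq_iff (z := 1)).2, (Int.floor_eq_iff (z := 0)).2]
  · norm_num
  all_goals push_cast; constructor <;> nlinarith

include hα hα0 hα1 in
lemma word_den_three (h2 : den α 2 = 1) : word α (den α 3) = 0 := by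
  have h := den_mul_sub_num α 3
  have h' := den_mul_sub_num α 2
  have hg := gap_pos hα hα0 hα1 3
  have hg' : gap α 3 < gap α 2 := gap_succ_lt hα hα0 hα1 2
  have hnum : num α 2 = 1 := by simp [num]
  rw [hnum, h2] at h'
  norm_num at h h'
  rw [word_eq_code hα0, code, if_pos]
  rw [(Int.floor_eq_iff (z := num α 3)).2, (Int.floor_eq_iff (z := num α 3)).2]
  all_goals push_cast; constructor <;> nlinarith

include hα hα0 hα1 in
lemma transfer_word_add_two (lam E : ℝ) {n : ℕ} (hq : 2 ≤ den α (n + 1)) :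
    transfer (potential lam (word α)) E 1 (den α (n + 2)) =
      transfer (potential lam (word α)) E 1 (den α n) *
        transfer (potential lam (word α)) E 1 (den α (n + 1)) ^ digit α n := by
  have key : ∀ (k : ℕ) (j : ℤ), 1 ≤ j → j + k * den α (n + 1) ≤ den α (n + 2) →
      word α (j + k * den α (n + 1)) = word α j := by
    intro k
    induction k with
    | zero => simp
    | succ k ih =>
      intro j hj hj'
      have hq' : (2 : ℤ) ≤ den α (n + 1) := by exact_mod_cast hq
      have hk : (0 : ℤ) ≤ k * den α (n + 1) := by positivity
      push_cast at hj' ⊢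
      rw [add_mul, one_mul] at hj' ⊢
      rw [← ih j hj (by omega), ← add_assoc]
      exact word_add_den hα hα0 hα1 (n + 1) (by omega)
        (show _ ≤ ((den α (n + 2) : ℕ) : ℤ) by omega)
  have hd : (den α (n + 2) : ℤ) = digit α n * den α (n + 1) + den α n := by
    rw [den_add_two]
    push_cast
    ring
  rw [den_add_two, transfer_add]
  congr 1
  · refine transfer_congr E fun j hj => ?_
    simp only [potential]
    rw [show (1 : ℤ) + (digit α n * den α (n + 1) : ℕ) + j =
      1 + j + (digit α n) * den α (n + 1) by push_cast; ring,
      key _ _ (by omega) (by omega)]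
  · refine transfer_mul_of_periodic E fun k hk j hj => ?_
    have h1 : ((k : ℤ) + 1) * den α (n + 1) ≤ digit α n * den α (n + 1) :=
      mul_le_mul_of_nonneg_right (by omega) (by positivity)
    simp only [potential]
    rw [show (1 : ℤ) + (k * den α (n + 1) : ℕ) + j = 1 + j + k * den α (n + 1) by push_cast; ring,
      key _ _ (by omega) (by linarith)]

include hα hα0 hα1 in
/-- The block matrices are the transfer matrices over the prefixes of length `q_n`. This fails for
`n = 0`, and for `n = 1` if `α > 1 / 2`. -/
lemma blockMat_eq_transfer (lam E : ℝ) (n : ℕ) :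
    blockMat α lam E (n + 2) = transfer (potential lam (word α)) E 1 (den α (n + 2)) := by
  have hone : potential lam (word α) (den α 2) = lam := by
    simp [potential, word_den_two hα hα0 hα1]
  have h2 : blockMat α lam E 2 = transfer (potential lam (word α)) E 1 (den α 2) := by
    obtain ⟨b, hb⟩ := Nat.exists_eq_add_of_le' (one_le_digit hα hα0 hα1 0)
    have hinv : (!![0, 1; -1, E] : Matrix (Fin 2) (Fin 2) ℝ) * step E 0 = 1 := by
      ext i j
      fin_cases i <;> fin_cases j <;> simp [step]
    rw [den_two, hb] at hone
    rw [den_two, blockMat_add_two, hb, transfer, show (1 : ℤ) + b = ((b + 1 : ℕ) : ℤ) by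
      push_cast; ring, hone, transfer_of_const (v := 0)]
    · rw [pow_succ', blockMat, blockMat, Matrix.mul_assoc, ← Matrix.mul_assoc _ (step E 0), hinv,
        Matrix.one_mul]
    · intro j hj
      rw [potential, word_of_lt_den_two hα hα0 hα1 (by omega)
        (by rw [den_two, hb]; push_cast; omega)]
      simp
  have h3 : blockMat α lam E 3 = transfer (potential lam (word α)) E 1 (den α 3) := by
    have hpos : 0 < den α 2 := den_pos hα hα0 hα1 1
    rcases Nat.lt_or_ge 1 (den α 2) with h | h
    · rw [transfer_word_add_two hα hα0 hα1 lam E (n := 1) h, blockMat_add_two, ← h2]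
      congr 1
      have : word α 1 = 0 := word_of_lt_den_two hα hα0 hα1 le_rfl (by exact_mod_cast h)
      simp [den, transfer, potential, this, blockMat]
    · have hd2 : den α 2 = 1 := by omega
      have hd3 : den α 3 = digit α 1 + 1 := by
        rw [den_add_two α 1, hd2]
        simp [den]
      have hw : ∀ j : ℕ, j < digit α 1 → word α (1 + j) = 1 := by
        intro j
        induction j with
        | zero =>
          intro _
          have := word_den_two hα hα0 hα1
          rw [hd2] at this
          simpa using this
        | succ j ih =>
          intro hj
          rw [← ih (by omega)]
          have := word_add_den hα hα0 hα1 2 (j := 1 + j) (by omega)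
            (by rw [hd3]; push_cast; omega)
          rw [hd2] at this
          rw [← this]
          push_cast
          ring_nf
      have hlast := word_den_three hα hα0 hα1 hd2
      rw [hd3] at hlast
      rw [hd3, transfer, blockMat_add_two, h2, hd2, transfer_of_const (m := digit α 1) (v := lam),
        show (1 : ℤ) + digit α 1 = ((digit α 1 + 1 : ℕ) : ℤ) by push_cast; ring]
      · rw [hd2] at hone
        simp only [transfer, potential, hlast]
        simp only [potential] at hone
        simp only [Nat.cast_zero, add_zero, mul_one]
        rw [show (1 : ℤ) = ((1 : ℕ) : ℤ) from rfl, hone]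
        simp [blockMat]
      · intro j hj
        simp [potential, hw j hj]
  induction n using Nat.twoStepInduction with
  | zero => exact h2
  | one => exact h3
  | more n ih0 ih1 =>
    have hq : 2 ≤ den α (n + 3) := by
      exact (Nat.le_add_left 2 n).trans (le_den_add_two hα hα0 hα1 (n + 1))
    rw [transfer_word_add_two hα hα0 hα1 lam E (n := n + 2) hq, blockMat_add_two, ih0, ih1]

end

/-! ### Spectra of self-adjoint operators and approximate eigenvectors -/

section Hilbert

variable {H : Type*} [NormedAddCommGroup H] [InnerProductSpace ℂ H] [CompleteSpace H]
  {T : H →L[ℂ] H}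

lemma isSelfAdjoint_sub_real (hT : IsSelfAdjoint T) (E : ℝ) :
    IsSelfAdjoint (algebraMap ℂ (H →L[ℂ] H) E - T) := by
  refine IsSelfAdjoint.sub ?_ hT
  rw [isSelfAdjoint_iff, ← algebraMap_star_comm]
  simp

lemma notMem_spectrum_of_bound (hT : IsSelfAdjoint T) {E c : ℝ} (hc : 0 < c)
    (h : ∀ u, c * ‖u‖ ≤ ‖T u - (E : ℂ) • u‖) : (E : ℂ) ∉ spectrum ℂ T := by
  rw [spectrum.notMem_iff]
  set A := algebraMap ℂ (H →L[ℂ] H) E - T with hA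
  have hsa : IsSelfAdjoint A := isSelfAdjoint_sub_real hT E
  have hb : ∀ u, ‖u‖ ≤ c⁻¹ * ‖A u‖ := fun u => by
    rw [inv_mul_eq_div, le_div_iff₀ hc, mul_comm]
    refine (h u).trans_eq ?_
    rw [hA, norm_sub_rev]
    simp [Algebra.algebraMap_eq_smul_one]
  rw [ContinuousLinearMap.isUnit_iff_bijective,
    ContinuousLinearMap.bijective_iff_dense_range_and_antilipschitz]
  refine ⟨?_, ⟨⟨c⁻¹, inv_nonneg.2 hc.le⟩, A.antilipschitz_of_bound hb⟩⟩
  rw [Submodule.topologicalClosure_eq_top_iff, ContinuousLinearMap.orthogonal_range,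
    ← ContinuousLinearMap.star_eq_adjoint, hsa.star_eq]
  rw [Submodule.eq_bot_iff]
  intro u hu
  have hu' : A u = 0 := hu
  have := hb u
  rw [hu', norm_zero, mul_zero] at this
  exact norm_le_zero_iff.1 this

/-- The resolvent of a self-adjoint operator at a real point is self-adjoint, so its norm is
attained on its spectrum; hence an approximate eigenvalue is close to the spectrum. -/
lemma exists_mem_spectrum_near (hT : IsSelfAdjoint T) {E ε : ℝ} {u : H}
    (hu : ‖T u - (E : ℂ) • u‖ < ε * ‖u‖) :
    ∃ E' : ℝ, |E' - E| < ε ∧ (E' : ℂ) ∈ spectrum ℂ T := by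
  have hu0 : u ≠ 0 := by
    rintro rfl
    simp at hu
  have hun : 0 < ‖u‖ := norm_pos_iff.2 hu0
  have hε : 0 < ε := by
    by_contra! h
    nlinarith [norm_nonneg (T u - (E : ℂ) • u)]
  have : Nontrivial H := ⟨⟨u, 0, hu0⟩⟩
  by_cases hE : (E : ℂ) ∈ spectrum ℂ T
  · exact ⟨E, by simpa using hε, hE⟩
  rw [spectrum.notMem_iff] at hE
  obtain ⟨A, hA⟩ := hE
  have hsa : IsSelfAdjoint (A : H →L[ℂ] H) := by
    rw [hA]
    exact isSelfAdjoint_sub_real hT E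
  have hinv : IsSelfAdjoint ((A⁻¹ : (H →L[ℂ] H)ˣ) : H →L[ℂ] H) := by
    have h1 : IsSelfAdjoint A := Units.ext hsa
    exact congrArg Units.val h1.inv
  obtain ⟨z, hz, hzn⟩ := spectrum.exists_nnnorm_eq_spectralRadius
    ((A⁻¹ : (H →L[ℂ] H)ˣ) : H →L[ℂ] H)
  rw [hinv.spectralRadius_eq_nnnorm, ENNReal.coe_inj] at hzn
  have hzn' : ‖z‖ = ‖((A⁻¹ : (H →L[ℂ] H)ˣ) : H →L[ℂ] H)‖ := congrArg NNReal.toReal hzn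
  have hAu : ((A⁻¹ : (H →L[ℂ] H)ˣ) : H →L[ℂ] H) ((A : H →L[ℂ] H) u) = u := by
    rw [← mul_apply_eq_comp, Units.inv_mul, one_apply_eq_self]
  have hAu' : ‖(A : H →L[ℂ] H) u‖ < ε * ‖u‖ := by
    rw [hA, norm_sub_rev] at *
    simpa [Algebra.algebraMap_eq_smul_one, norm_sub_rev] using hu
  have hle := ((A⁻¹ : (H →L[ℂ] H)ˣ) : H →L[ℂ] H).le_opNorm ((A : H →L[ℂ] H) u)
  rw [hAu, ← hzn'] at hle
  have hzpos : 0 < ‖z‖ := by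
    by_contra! h
    have h0 : ‖z‖ = 0 := le_antisymm h (norm_nonneg _)
    rw [h0, zero_mul] at hle
    linarith
  have hzε : ‖z⁻¹‖ < ε := by
    rw [norm_inv, inv_lt_comm₀ hzpos hε, inv_eq_one_div, div_lt_iff₀ hε]
    by_contra! h
    have h1 : ‖u‖ < ‖z‖ * (ε * ‖u‖) := hle.trans_lt (mul_lt_mul_of_pos_left hAu' hzpos)
    nlinarith
  have hz' : z⁻¹ ∈ spectrum ℂ (A : H →L[ℂ] H) := by
    rw [← spectrum.inv₀_mem_inv_iff, inv_inv]
    exact hz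
  rw [hA, ← spectrum.singleton_sub_eq] at hz'
  obtain ⟨E₀, hE₀, w, hw, hwz⟩ := Set.mem_sub.1 hz'
  rw [Set.mem_singleton_iff] at hE₀
  subst hE₀
  have hwre := hT.mem_spectrum_eq_re hw
  refine ⟨w.re, ?_, hwre ▸ hw⟩
  rw [← hwz, hwre, ← Complex.ofReal_sub, Complex.norm_real, Real.norm_eq_abs, abs_sub_comm] at hzε
  exact hzε

end Hilbert

/-! ### Finitely supported approximate eigenvectors -/

lemma norm_translate (a : ℤ) (u : EllTwo) : ‖translate a u‖ = ‖u‖ := by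
  have h : ∀ (a : ℤ) (u : EllTwo), ‖translate a u‖ ≤ ‖u‖ := fun a u => by
    have := (translate a).le_of_opNorm_le (LinearMap.mkContinuous_norm_le _ zero_le_one _) u
    rwa [one_mul] at this
  refine le_antisymm (h a u) ?_
  have h2 : translate (-a) (translate a u) = u := by
    ext n
    rw [translate_apply, translate_apply, neg_add_cancel_right]
  calc ‖u‖ = ‖translate (-a) (translate a u)‖ := by rw [h2]
    _ ≤ _ := h _ _

lemma inner_translate (a : ℤ) (u v : EllTwo) :
    inner ℂ (translate a u) v = inner ℂ u (translate (-a) v) := by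
  rw [lp.inner_eq_tsum, lp.inner_eq_tsum, ← (Equiv.subRight a).tsum_eq]
  refine tsum_congr fun n => ?_
  rw [translate_apply, translate_apply, Equiv.subRight_apply, sub_add_cancel, sub_eq_add_neg]

lemma isSelfAdjoint_schrodinger (V : ℤ → ℝ) (C : ℝ) (hV : ∀ n, |V n| ≤ C) :
    IsSelfAdjoint (schrodinger V C hV) := by
  rw [ContinuousLinearMap.isSelfAdjoint_iff_isSymmetric]
  intro u v
  have h : inner ℂ (mulPotential V C hV u) v = inner ℂ u (mulPotential V C hV v) := by
    rw [lp.inner_eq_tsum, lp.inner_eq_tsum]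
    refine tsum_congr fun n => ?_
    rw [mulPotential_apply, mulPotential_apply]
    simp only [RCLike.inner_apply, map_mul, Complex.conj_ofReal]
    ring
  have h1 := inner_translate 1 u v
  have h2 := inner_translate (-1) u v
  rw [neg_neg] at h2
  simp only [schrodinger, ContinuousLinearMap.coe_coe, add_apply,
    inner_add_left, inner_add_right, h, h1, h2]
  ring

lemma isSelfAdjoint_sturmOp (lam : ℝ) (ω : Seq) : IsSelfAdjoint (sturmOp lam ω) :=
  isSelfAdjoint_schrodinger _ _ _

lemma sturmOp_sub_apply (lam : ℝ) (ω : Seq) (E : ℝ) (u : EllTwo) (n : ℤ) :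
    (sturmOp lam ω u - (E : ℂ) • u) n = defect (potential lam ω) E u n := rfl

lemma exists_finite_support_mem {U : Set EllTwo} (hU : IsOpen U) {u : EllTwo} (hu : u ∈ U) :
    ∃ (N : ℕ) (v : EllTwo), (∀ n : ℤ, N < |n| → v n = 0) ∧ v ∈ U := by
  have hlim := lp.hasSum_single (p := 2) ENNReal.ofNat_ne_top u
  obtain ⟨s, hs⟩ := (hlim.eventually (hU.mem_nhds hu)).exists
  refine ⟨s.sup Int.natAbs, _, fun n hn => ?_, hs⟩
  rw [lp.coeFn_sum, Finset.sum_apply]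
  refine Finset.sum_eq_zero fun i hi => ?_
  have hi' : i.natAbs ≤ s.sup Int.natAbs := Finset.le_sup hi
  have hne : n ≠ i := by
    rintro rfl
    rw [Int.abs_eq_natAbs] at hn
    omega
  exact lp.single_apply_ne 2 i _ hne

lemma exists_quasimode {lam : ℝ} {ω : Seq} {E : ℝ} (hE : (E : ℂ) ∈ spectrum ℂ (sturmOp lam ω))
    {ε : ℝ} (hε : 0 < ε) :
    ∃ (N : ℕ) (u : EllTwo), (∀ n : ℤ, N < |n| → u n = 0) ∧
      ‖sturmOp lam ω u - (E : ℂ) • u‖ < ε * ‖u‖ := by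
  obtain ⟨u, hu⟩ : ∃ u, ‖sturmOp lam ω u - (E : ℂ) • u‖ < ε * ‖u‖ := by
    by_contra! h
    exact notMem_spectrum_of_bound (isSelfAdjoint_sturmOp lam ω) hε h hE
  generalize sturmOp lam ω = T at hu ⊢
  have hopen : IsOpen {u : EllTwo | ‖T u - (E : ℂ) • u‖ < ε * ‖u‖} :=
    isOpen_lt (by fun_prop) (by fun_prop)
  exact exists_finite_support_mem hopen hu

/-- A finitely supported vector feels only a finite piece of the potential. -/
lemma norm_sturmOp_translate {lam : ℝ} {ω ω' : Seq} {N : ℕ} {k : ℤ}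
    (h : ∀ j : ℤ, |j| ≤ N → ω' (k + j) = ω j) {u : EllTwo} (hu : ∀ n : ℤ, N < |n| → u n = 0)
    (E : ℝ) : ‖sturmOp lam ω' (translate (-k) u) - (E : ℂ) • translate (-k) u‖ =
      ‖sturmOp lam ω u - (E : ℂ) • u‖ := by
  rw [← norm_translate (-k) (sturmOp lam ω u - (E : ℂ) • u)]
  congr 1
  ext n
  rw [translate_apply, sturmOp_sub_apply, sturmOp_sub_apply, defect, defect, translate_apply,
    translate_apply, translate_apply]
  have h1 : (potential lam ω' n : ℂ) * u (n + -k) = potential lam ω (n + -k) * u (n + -k) := by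
    by_cases hn : |n + -k| ≤ N
    · have := h _ hn
      rw [add_neg_cancel_comm_assoc] at this
      rw [potential, potential, this]
    · rw [hu _ (not_le.1 hn), mul_zero, mul_zero]
  rw [h1, show n + 1 + -k = n + -k + 1 by ring, show n - 1 + -k = n + -k - 1 by ring]

/-- If every finite piece of `ω` occurs in `ω'`, then the spectrum of `H_ω` is contained in that
of `H_ω'`. -/
lemma spectrum_sturmOp_subset {lam : ℝ} {ω ω' : Seq}
    (h : ∀ N : ℕ, ∃ k : ℤ, ∀ j : ℤ, |j| ≤ N → ω' (k + j) = ω j) :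
    spectrum ℂ (sturmOp lam ω) ⊆ spectrum ℂ (sturmOp lam ω') := by
  intro z hz
  obtain ⟨E, rfl⟩ : ∃ E : ℝ, z = E := ⟨_, (isSelfAdjoint_sturmOp lam ω).mem_spectrum_eq_re hz⟩
  rw [← (spectrum.isClosed (𝕜 := ℂ) (sturmOp lam ω')).closure_eq, Metric.mem_closure_iff]
  intro ε hε
  obtain ⟨N, u, hu, hn⟩ := exists_quasimode hz hε
  obtain ⟨k, hk⟩ := h N
  rw [← norm_sturmOp_translate hk hu, ← norm_translate (-k) u] at hn
  obtain ⟨E', hE', hmem⟩ := exists_mem_spectrum_near (isSelfAdjoint_sturmOp lam ω') hn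
  refine ⟨E', hmem, ?_⟩
  rwa [Complex.dist_eq, ← Complex.ofReal_sub, Complex.norm_real, Real.norm_eq_abs, abs_sub_comm]

/-- A hyperbolic energy of a periodic potential lies in the resolvent set: by the three-term
recurrence with coefficient `x`, the norm of `(|x| - 2) u` is controlled by that of
`(H - E) u`. -/
lemma abs_trace_le_of_periodic {lam : ℝ} {ω : Seq} {q : ℕ} (hper : ∀ n, ω (n + q) = ω n)
    {E : ℝ} (hE : (E : ℂ) ∈ spectrum ℂ (sturmOp lam ω)) (n₀ : ℤ) :
    |(transfer (potential lam ω) E n₀ q).trace| ≤ 2 := by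
  by_contra! hx
  have hperV : ∀ n, potential lam ω (n + q) = potential lam ω n := fun n => by
    simp [potential, hper]
  set x := (transfer (potential lam ω) E n₀ q).trace with hxdef
  obtain ⟨K, hK, h⟩ := exists_recurrence_bound (abs_potential_le lam ω) E q
  have key : ∀ u : EllTwo, (|x| - 2) * ‖u‖ ≤
      K * (2 * q) * ‖sturmOp lam ω u - (E : ℂ) • u‖ := by
    intro u
    set f := sturmOp lam ω u - (E : ℂ) • u with hf
    let F : EllTwo := ⟨fun n => (‖f n‖ : ℂ), (lp.memℓp f).mono' (fun n => by simp)⟩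
    have hF : ‖F‖ ≤ ‖f‖ := lp.norm_mono (by norm_num) fun n => by simp [F]
    let S : EllTwo := (K : ℂ) • ∑ j ∈ Finset.range (2 * q), translate j F
    have hS : ‖S‖ ≤ K * (2 * q) * ‖f‖ := by
      rw [norm_smul, Complex.norm_real, Real.norm_eq_abs, abs_of_nonneg hK, mul_assoc]
      refine mul_le_mul_of_nonneg_left ?_ hK
      refine (norm_sum_le _ _).trans ?_
      simp only [norm_translate, Finset.sum_const, Finset.card_range, nsmul_eq_mul]
      push_cast
      exact mul_le_mul_of_nonneg_left hF (by positivity)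
    let g : EllTwo := translate (2 * q : ℕ) u - (x : ℂ) • translate q u + u
    have hg : ‖g‖ ≤ ‖S‖ := by
      refine lp.norm_mono (by norm_num) fun n => ?_
      have h1 := (h u n fun j _ => by
        rw [add_right_comm]
        exact hperV _).1
      have h2 : (transfer (potential lam ω) E n q).trace = x :=
        trace_transfer_of_periodic E hperV n n₀
      rw [h2] at h1
      have h3 : S n = ((K * ∑ j ∈ Finset.range (2 * q), ‖f (n + j)‖ : ℝ) : ℂ) := by
        simp only [S, lp.coeFn_smul, lp.coeFn_sum, Pi.smul_apply, Finset.sum_apply, smul_eq_mul]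
        push_cast
        rfl
      rw [h3, Complex.norm_real]
      exact h1.trans (le_abs_self _)
    have hxu : ‖(x : ℂ) • translate q u‖ = |x| * ‖u‖ := by
      rw [norm_smul, Complex.norm_real, Real.norm_eq_abs, norm_translate]
    have h4 : (x : ℂ) • translate q u = translate (2 * q : ℕ) u + u - g := by
      simp only [g]
      abel
    have h5 : |x| * ‖u‖ ≤ ‖u‖ + ‖u‖ + ‖g‖ := by
      rw [← hxu, h4]
      refine (norm_sub_le _ _).trans (add_le_add_left ((norm_add_le _ _).trans ?_) _)
      rw [norm_translate]
    linarith
  refine notMem_spectrum_of_bound (isSelfAdjoint_sturmOp lam ω)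
    (c := (|x| - 2) / (K * (2 * q) + 1)) (div_pos (by linarith) (by positivity)) (fun u => ?_) hE
  rw [div_mul_eq_mul_div, div_le_iff₀ (by positivity)]
  refine (key u).trans ?_
  rw [mul_comm (‖_‖), add_mul, one_mul]
  exact le_add_of_nonneg_right (norm_nonneg _)

/-! ### Recurrence in the hull and the deterministic spectrum -/

section

variable {α : ℝ} (hα : Irrational α) (hα0 : 0 < α) (hα1 : α < 1)

include hα hα0 hα1 in
/-- Every finite piece of a coding occurs in every coding with bounded gaps. -/
lemma exists_occurrence (θ : ℝ) (N : ℕ) :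
    ∃ L : ℕ, ∀ (θ' : ℝ) (k₀ : ℤ), ∃ k : ℕ, k ≤ L ∧
      ∀ j : ℤ, |j| ≤ N → code α θ' (k₀ + k + j) = code α θ j := by
  obtain ⟨η, hη, h⟩ := exists_code_eq_right α θ N
  obtain ⟨L, hL⟩ := exists_bounded_return hα hα0 hα1 hη
  refine ⟨L, fun θ' k₀ => ?_⟩
  obtain ⟨k, hk, m, h0, h1⟩ := hL (θ' + k₀ * α - θ)
  refine ⟨k, hk, fun j hj => ?_⟩
  rw [← h _ h0 h1 j hj, add_comm _ j, ← code_add_int α θ' (k₀ + k) (-m) j]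
  congr 1
  push_cast
  ring

include hα hα0 hα1 in
lemma code_mem_hull (θ : ℝ) : code α θ ∈ hull α := by
  have h : ∀ i : ℕ, ∃ k : ℕ, i ≤ k ∧ ∀ j : ℤ, |j| ≤ i → word α (k + j) = code α θ j := by
    intro i
    obtain ⟨L, hL⟩ := exists_occurrence hα hα0 hα1 θ i
    obtain ⟨k, _, hk⟩ := hL 0 i
    refine ⟨i + k, Nat.le_add_right _ _, fun j hj => ?_⟩
    rw [word_eq_code hα0, ← hk j hj]
    push_cast
    rfl
  choose k hk hkj using h
  refine ⟨k, tendsto_atTop_mono hk tendsto_id, tendsto_pi_nhds.2 fun j => ?_⟩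
  refine tendsto_const_nhds.congr' ?_
  filter_upwards [eventually_ge_atTop j.natAbs] with i hi
  rw [shift_iterate, add_comm j, hkj i j (by rw [Int.abs_eq_natAbs]; exact_mod_cast hi)]

lemma exists_word_eq_of_mem_hull {ω : Seq} (hω : ω ∈ hull α) (N : ℕ) :
    ∃ k : ℤ, ∀ j : ℤ, |j| ≤ N → word α (k + j) = ω j := by
  obtain ⟨k, _, hk⟩ := hω
  rw [tendsto_pi_nhds] at hk
  have h : ∀ᶠ i in atTop, ∀ j ∈ Finset.Icc (-(N : ℤ)) N, shift^[k i] (word α) j = ω j := by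
    rw [Finset.eventually_all]
    intro j _
    have := hk j
    rwa [nhds_discrete, tendsto_pure] at this
  obtain ⟨i, hi⟩ := h.exists
  refine ⟨k i, fun j hj => ?_⟩
  rw [← hi j (Finset.mem_Icc.2 (abs_le.1 hj)), shift_iterate, add_comm]

include hα hα0 hα1 in
/-- The hull is minimal, so all its elements give rise to the same spectrum. -/
lemma spectrum_eq_of_mem_hull (lam : ℝ) {ω : Seq} (hω : ω ∈ hull α) :
    spectrum ℂ (sturmOp lam ω) = spectrum ℂ (sturmOp lam (word α)) := by
  refine (spectrum_sturmOp_subset (exists_word_eq_of_mem_hull hω)).antisymm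
    (spectrum_sturmOp_subset fun N => ?_)
  obtain ⟨L, hL⟩ := exists_occurrence hα hα0 hα1 0 N
  obtain ⟨k₀, hk₀⟩ := exists_word_eq_of_mem_hull hω (N + L)
  obtain ⟨k, hk, hkj⟩ := hL 0 k₀
  refine ⟨k, fun j hj => ?_⟩
  rw [← hk₀ (k + j), word_eq_code hα0, ← hkj j hj, add_assoc]
  rw [abs_le] at hj ⊢
  push_cast
  omega

/-! ### Periodic approximants -/

/-- The periodic sequence of period `q_n` that agrees with the Sturmian word on `1, …, q_n`. -/
noncomputable def periodicWord (α : ℝ) (n : ℕ) : Seq := fun j => word α ((j - 1) % den α n + 1)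

lemma periodicWord_add (α : ℝ) (n : ℕ) (j : ℤ) :
    periodicWord α n (j + den α n) = periodicWord α n j := by
  rw [periodicWord, periodicWord, add_sub_right_comm, Int.add_emod_right]

lemma periodicWord_eq {n : ℕ} {j : ℤ} (hj : 1 ≤ j) (hj' : j ≤ den α n) :
    periodicWord α n j = word α j := by
  rw [periodicWord, Int.emod_eq_of_lt (by omega) (by omega), sub_add_cancel]

include hα hα0 hα1 in
lemma trace_transfer_periodicWord (lam E : ℝ) {n : ℕ} (hn : 2 ≤ n) (k : ℤ) :
    (transfer (potential lam (periodicWord α n)) E k (den α n)).trace = blockTrace α lam E n := by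
  obtain ⟨m, rfl⟩ := Nat.exists_eq_add_of_le' hn
  rw [blockTrace, blockMat_eq_transfer hα hα0 hα1, trace_transfer_of_periodic E _ k 1]
  · congr 1
    refine transfer_congr E fun j hj => ?_
    rw [potential, potential, periodicWord_eq (by omega) (by omega)]
  · intro j
    rw [potential, potential, periodicWord_add]

include hα hα0 hα1 in
/-- Energies in the spectrum never escape: escape at a level is an open condition which forces all
energies nearby into the resolvent sets of the later periodic approximants, and these approximate
the Sturmian potential on arbitrarily long pieces. -/
lemma not_escapes_of_mem_spectrum {lam E : ℝ}
    (hE : (E : ℂ) ∈ spectrum ℂ (sturmOp lam (word α))) (n : ℕ) : ¬ Escapes α lam E n := by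
  intro hesc
  obtain ⟨r, hr, hball⟩ := Metric.isOpen_iff.1 (isOpen_escapes α lam n) E hesc
  obtain ⟨N, u, hu, hn⟩ := exists_quasimode hE hr
  obtain ⟨L, hL⟩ := exists_occurrence hα hα0 hα1 0 N
  obtain ⟨k, _, hk⟩ := hL 0 (N + 1)
  obtain ⟨m, hm, hmn⟩ := (((tendsto_den hα hα0 hα1).eventually_ge_atTop (N + 1 + k + N)).and
    (eventually_ge_atTop (n + 2))).exists
  have hpat : ∀ j : ℤ, |j| ≤ N → periodicWord α m ((N + 1 + k : ℕ) + j) = word α j := by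
    intro j hj
    have hj' := abs_le.1 hj
    rw [periodicWord_eq (by push_cast; omega) (by push_cast; omega), word_eq_code hα0, ← hk j hj]
    push_cast
    rfl
  rw [← norm_sturmOp_translate hpat hu, ← norm_translate (-((N + 1 + k : ℕ) : ℤ)) u] at hn
  obtain ⟨E', hE', hmem⟩ := exists_mem_spectrum_near (isSelfAdjoint_sturmOp lam _) hn
  have h1 : Escapes α lam E' n := hball (by rwa [Metric.mem_ball, Real.dist_eq])
  have h2 := h1.two_lt hα hα0 hα1 (k := m) (by omega)
  have h3 := abs_trace_le_of_periodic (periodicWord_add α m) hmem 1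
  rw [trace_transfer_periodicWord hα hα0 hα1 lam E' (by omega)] at h3
  linarith

/-! ### Squares and the absence of decaying solutions -/

/-- The sequences which carry on the sites `1, …, 2 q_n` the square of a cyclic permutation of the
prefix of length `q_n` of the Sturmian word. -/
def squareSet (α : ℝ) (n : ℕ) : Set Seq :=
  {ω | ∃ k : ℕ, k < den α n ∧ ∀ j : ℤ, 1 ≤ j → j ≤ 2 * den α n → ω j = periodicWord α n (j - k)}

lemma eq_zero_of_isSolution {V : ℤ → ℝ} {E : ℝ} {φ : ℤ → ℂ} (h : IsSolution V E φ)
    (h0 : φ 0 = 0) (h1 : φ 1 = 0) : φ = 0 := by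
  have hr : ∀ n : ℕ, φ n = 0 ∧ φ (n + 1) = 0 := by
    intro n
    induction n with
    | zero => exact ⟨h0, by simpa using h1⟩
    | succ n ih =>
      refine ⟨by push_cast; exact ih.2, ?_⟩
      have := h (n + 1)
      rw [add_sub_cancel_right, ih.1, ih.2] at this
      push_cast
      simpa using this
  have hl : ∀ n : ℕ, φ (-n) = 0 ∧ φ (-n + 1) = 0 := by
    intro n
    induction n with
    | zero => exact ⟨by simpa using h0, by simpa using h1⟩
    | succ n ih =>
      have := h (-n)
      rw [ih.1, ih.2] at this
      push_cast
      refine ⟨?_, by rw [neg_add_rev, add_comm (-1 : ℤ), neg_add_cancel_right]; exact ih.1⟩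
      rw [neg_add, ← sub_eq_add_neg]
      simpa using this
  funext n
  obtain ⟨m, rfl | rfl⟩ := n.eq_nat_or_neg
  · exact (hr m).1
  · exact (hl m).1

include hα hα0 hα1 in
/-- The two-block Gordon argument: squares at infinitely many scales, together with bounded traces,
exclude solutions that decay at `+∞`. -/
lemma not_sqSummable_of_frequently_square {lam E : ℝ} {ω : Seq}
    (hω : ∃ᶠ n in atTop, ω ∈ squareSet α n) {C : ℝ}
    (hC : ∀ n, |blockTrace α lam E (n + 1)| ≤ C) {φ : ℤ → ℂ} (hφ : φ ≠ 0)
    (hsol : IsSolution (potential lam ω) E φ) : ¬ SqSummableAtTop φ := by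
  intro hsum
  have hlim : Tendsto (fun n : ℕ => ‖φ n‖) atTop (𝓝 0) := by
    have h := (Real.continuous_sqrt.tendsto 0).comp hsum.tendsto_atTop_zero
    rw [Real.sqrt_zero] at h
    exact h.congr fun n => Real.sqrt_sq (norm_nonneg _)
  have hdef : ∀ n, defect (potential lam ω) E φ n = 0 := fun n => by
    rw [defect, hsol n, sub_self]
  have hden := tendsto_den hα hα0 hα1
  have key : ∃ᶠ n in atTop,
      ‖φ 1‖ ≤ C * ‖φ ((den α n + 1 : ℕ) : ℤ)‖ + ‖φ ((2 * den α n + 1 : ℕ) : ℤ)‖ ∧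
      ‖φ 0‖ ≤ C * ‖φ (den α n : ℤ)‖ + ‖φ ((2 * den α n : ℕ) : ℤ)‖ := by
    refine (hω.and_eventually (eventually_ge_atTop 2)).mono ?_
    rintro n ⟨⟨k, hk, hsq⟩, hn⟩
    obtain ⟨K, _, h⟩ := exists_recurrence_bound (abs_potential_le lam ω) E (den α n)
    obtain ⟨h0, h1⟩ := h φ 1 fun j hj => by
      rw [potential, potential, hsq _ (by omega) (by omega), hsq _ (by omega) (by omega),
        ← periodicWord_add α n (1 + j - k)]
      ring_nf
    simp only [hdef, norm_zero, Finset.sum_const_zero, mul_zero] at h0 h1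
    have htr : (transfer (potential lam ω) E 1 (den α n)).trace = blockTrace α lam E n := by
      rw [← trace_transfer_periodicWord hα hα0 hα1 lam E hn (1 - k)]
      congr 1
      refine transfer_congr E fun j hj => ?_
      rw [potential, potential, hsq _ (by omega) (by omega), add_sub_right_comm]
    have hx : |blockTrace α lam E n| ≤ C := by
      obtain ⟨m, rfl⟩ := Nat.exists_eq_add_of_le' (one_le_two.trans hn)
      exact hC m
    rw [htr] at h0 h1
    have fin : ∀ a b c : ℂ, ‖a - (blockTrace α lam E n : ℂ) * b + c‖ ≤ 0 →
        ‖c‖ ≤ C * ‖b‖ + ‖a‖ := by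
      intro a b c habc
      have hc : c = (blockTrace α lam E n : ℂ) * b - a := by
        linear_combination norm_le_zero_iff.1 habc
      rw [hc]
      refine (norm_sub_le _ _).trans (add_le_add_left ?_ _)
      rw [norm_mul, Complex.norm_real]
      exact mul_le_mul_of_nonneg_right hx (norm_nonneg _)
    have f0 := fin _ _ _ h0
    have f1 := fin _ _ _ h1
    rw [add_comm (1 : ℤ), add_comm (1 : ℤ)] at f0
    rw [add_sub_right_comm, add_sub_right_comm, sub_self, zero_add, zero_add] at f1
    refine ⟨?_, f1⟩
    push_cast at f0 ⊢
    exact f0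
  have hlim1 : Tendsto (fun n => C * ‖φ ((den α n + 1 : ℕ) : ℤ)‖ +
      ‖φ ((2 * den α n + 1 : ℕ) : ℤ)‖) atTop (𝓝 0) := by
    have h1 := (hlim.comp (tendsto_atTop_mono (fun n => (den α n).le_succ) hden)).const_mul C
    have h2 := hlim.comp (tendsto_atTop_mono
      (fun n => (by omega : den α n ≤ 2 * den α n + 1)) hden)
    simpa using h1.add h2
  have hlim0 : Tendsto (fun n => C * ‖φ (den α n : ℤ)‖ +
      ‖φ ((2 * den α n : ℕ) : ℤ)‖) atTop (𝓝 0) := by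
    have h1 := (hlim.comp hden).const_mul C
    have h2 := hlim.comp (tendsto_atTop_mono
      (fun n => (by omega : den α n ≤ 2 * den α n)) hden)
    simpa using h1.add h2
  refine hφ (eq_zero_of_isSolution hsol ?_ ?_)
  · exact norm_le_zero_iff.1 (ge_of_tendsto_of_frequently hlim0 (key.mono fun _ h => h.2))
  · exact norm_le_zero_iff.1 (ge_of_tendsto_of_frequently hlim1 (key.mono fun _ h => h.1))

end

/-! ### Lebesgue measure on the circle -/

/-- Lebesgue measure on the fundamental domain `(0, 1]` of the circle. -/
noncomputable def circleMeasure : Measure ℝ := volume.restrict (Set.Ioc 0 1)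

instance : IsProbabilityMeasure circleMeasure :=
  ⟨by simp [circleMeasure, Real.volume_Ioc]⟩

lemma integral_circleMeasure (f : ℝ → ℝ) : ∫ θ, f θ ∂circleMeasure = ∫ θ in (0 : ℝ)..1, f θ := by
  rw [intervalIntegral.integral_of_le zero_le_one, circleMeasure]

/-- Rotation invariance, for `1`-periodic sets. -/
lemma circleMeasure_real_preimage_add {A : Set ℝ} (hA : MeasurableSet A)
    (hper : ∀ θ, θ + 1 ∈ A ↔ θ ∈ A) (c : ℝ) :
    circleMeasure.real ((fun θ => θ + c) ⁻¹' A) = circleMeasure.real A := by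
  have hp : Function.Periodic (A.indicator (1 : ℝ → ℝ)) 1 := fun θ => by
    by_cases h : θ ∈ A
    · rw [Set.indicator_of_mem h, Set.indicator_of_mem ((hper θ).2 h)]
      rfl
    · rw [Set.indicator_of_notMem h, Set.indicator_of_notMem (mt (hper θ).1 h)]
  have hc : MeasurableSet ((fun θ => θ + c) ⁻¹' A) := measurable_id.add_const c hA
  rw [← integral_indicator_one hc, ← integral_indicator_one hA,
    integral_circleMeasure, integral_circleMeasure]
  have h1 : ∀ θ, ((fun θ => θ + c) ⁻¹' A).indicator (1 : ℝ → ℝ) θ =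
      A.indicator (1 : ℝ → ℝ) (θ + c) := fun θ => rfl
  simp only [h1]
  rw [intervalIntegral.integral_comp_add_right (A.indicator (1 : ℝ → ℝ)), zero_add, add_comm 1 c,
    hp.intervalIntegral_add_eq c 0, zero_add]

lemma measurable_code (α : ℝ) : Measurable fun θ => code α θ := by
  refine measurable_pi_iff.2 fun n => ?_
  have h : ∀ m : ℤ, Measurable fun θ : ℝ => ⌊(m : ℝ) * α + θ⌋ := fun m =>
    Int.measurable_floor.comp (measurable_const.add measurable_id)
  exact Measurable.ite (measurableSet_eq_fun (h (n + 1)) (h n)) measurable_const measurable_const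

/-! ### Frequencies of words -/

/-- The points of the line whose coding begins, at the position `0`, with the finite word `w`. -/
def matchSet (α : ℝ) {l : ℕ} (w : Fin l → Fin 2) : Set ℝ := {θ | ∀ i : Fin l, code α θ i = w i}

/-- The number of visits of the orbit of `θ` to `matchSet α w` at the times `1, …, n`. -/
noncomputable def visits (α : ℝ) {l : ℕ} (w : Fin l → Fin 2) (θ : ℝ) (n : ℕ) : ℝ :=
  ∑ j ∈ Finset.Icc 1 n, (matchSet α w).indicator 1 (θ + (j : ℝ) * α)

section

variable {α : ℝ} {l : ℕ} (w : Fin l → Fin 2)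

lemma measurableSet_matchSet : MeasurableSet (matchSet α w) := by
  have : matchSet α w = ⋂ i : Fin l, (fun θ => code α θ) ⁻¹' {ω | ω i = w i} := by
    ext θ
    simp [matchSet]
  rw [this]
  exact MeasurableSet.iInter fun i =>
    measurable_code α (measurableSet_eq_fun (measurable_pi_apply _) measurable_const)

lemma code_add_intCast (α θ : ℝ) (m n : ℤ) : code α (θ + m) n = code α θ n := by
  simpa using code_add_int α θ 0 m n

lemma add_intCast_mem_matchSet (θ : ℝ) (m : ℤ) : θ + m ∈ matchSet α w ↔ θ ∈ matchSet α w := by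
  simp [matchSet, code_add_intCast]

lemma indicator_matchSet_add_intCast (θ : ℝ) (m : ℤ) :
    (matchSet α w).indicator (1 : ℝ → ℝ) (θ + m) = (matchSet α w).indicator 1 θ := by
  by_cases h : θ ∈ matchSet α w
  · rw [Set.indicator_of_mem h, Set.indicator_of_mem ((add_intCast_mem_matchSet w θ m).2 h)]
    rfl
  · rw [Set.indicator_of_notMem h,
      Set.indicator_of_notMem (mt (add_intCast_mem_matchSet w θ m).1 h)]

lemma visits_add_intCast (θ : ℝ) (m : ℤ) (n : ℕ) : visits α w (θ + m) n = visits α w θ n := by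
  refine Finset.sum_congr rfl fun j _ => ?_
  rw [add_right_comm, indicator_matchSet_add_intCast]

lemma occurrences_eq_visits (hα0 : 0 < α) (n : ℕ) : (occurrences α w n : ℝ) = visits α w 0 n := by
  classical
  rw [occurrences, visits, Finset.card_filter]
  push_cast
  refine Finset.sum_congr rfl fun j _ => ?_
  have h : ∀ i : ℤ, word α (j + i) = code α (0 + j * α) i := fun i => by
    have := code_add_int α 0 j 0 i
    push_cast at this
    rw [add_zero] at this
    rw [word_eq_code hα0, this, add_comm]
  simp only [h, Set.indicator_apply, matchSet, Set.mem_ofPred_eq, Pi.one_apply]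

lemma abs_indicator_sub_le (x y : ℝ) :
    |(matchSet α w).indicator (1 : ℝ → ℝ) x - (matchSet α w).indicator 1 y| ≤ 1 := by
  classical
  rw [Set.indicator_apply, Set.indicator_apply]
  split_ifs <;> simp

lemma abs_visits_rotate_le (θ : ℝ) (k n : ℕ) :
    |visits α w (θ + k * α) n - visits α w θ n| ≤ k := by
  have h1 : ∀ θ, |visits α w (θ + α) n - visits α w θ n| ≤ 1 := fun θ => by
    have h : visits α w (θ + α) n - visits α w θ n =
        (matchSet α w).indicator 1 (θ + α + n * α) - (matchSet α w).indicator 1 (θ + α) := by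
      induction n with
      | zero => simp [visits]
      | succ n ih =>
        rw [visits, visits, Finset.sum_Icc_succ_top (by omega), Finset.sum_Icc_succ_top (by omega),
          ← visits, ← visits]
        have : θ + ((n + 1 : ℕ) : ℝ) * α = θ + α + n * α := by push_cast; ring
        rw [this]
        linarith
    rw [h]
    exact abs_indicator_sub_le w _ _
  induction k with
  | zero => simp
  | succ k ih =>
    have h2 := h1 (θ + k * α)
    rw [show θ + ((k + 1 : ℕ) : ℝ) * α = θ + k * α + α by push_cast; ring]
    have := abs_sub_le (visits α w (θ + k * α + α) n) (visits α w (θ + k * α) n) (visits α w θ n)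
    push_cast
    linarith

/-- A set of times with pairwise distances at least `Q` is sparse. -/
lemma card_le_of_separated {s : Finset ℕ} {n Q : ℕ} (hQ : 0 < Q) (hs : ∀ j ∈ s, j ≤ n)
    (h : ∀ i ∈ s, ∀ j ∈ s, i < j → i + Q ≤ j) : s.card ≤ n / Q + 1 := by
  have : s.card ≤ (Finset.range (n / Q + 1)).card := by
    refine Finset.card_le_card_of_injOn (· / Q) (fun j hj => ?_) (fun i hi j hj hij => ?_)
    · simp only [Finset.coe_range, Set.mem_Iio]
      exact Nat.lt_succ_of_le (Nat.div_le_div_right (hs j hj))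
    · by_contra hne
      have hlt : ∀ i ∈ s, ∀ j ∈ s, i < j → i / Q < j / Q := fun i hi j hj hij => by
        have := Nat.div_le_div_right (c := Q) (h i hi j hj hij)
        rw [Nat.add_div_right _ hQ] at this
        omega
      simp only at hij
      rcases lt_or_gt_of_ne hne with h' | h'
      · exact absurd (hlt i hi j hj h') (by omega)
      · exact absurd (hlt j hj i hi h') (by omega)
  simpa using this

variable (hα : Irrational α) (hα0 : 0 < α) (hα1 : α < 1)

include hα hα0 hα1 in
/-- A short translation of the starting point changes the visits only at the times when the orbit is
close to an endpoint of one of the intervals of `matchSet α w`, and such times are far apart. -/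
lemma abs_visits_translate_le (m : ℕ) {s : ℝ} (hs : 0 ≤ s) (hs' : s < gap α m) (θ : ℝ) (n : ℕ) :
    |visits α w (θ + s) n - visits α w θ n| ≤
      (l + 1) * (n / (den α (m + 1) : ℝ) + 1) := by
  classical
  let cross : ℕ → ℕ → Prop := fun i j => ⌊(i : ℝ) * α + (θ + j * α + s)⌋ ≠
    ⌊(i : ℝ) * α + (θ + j * α)⌋
  have hterm : ∀ j : ℕ, |(matchSet α w).indicator (1 : ℝ → ℝ) (θ + s + j * α) -
      (matchSet α w).indicator 1 (θ + j * α)| ≤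
        ∑ i ∈ Finset.range (l + 1), if cross i j then 1 else 0 := by
    intro j
    by_cases hc : ∃ i ∈ Finset.range (l + 1), cross i j
    · obtain ⟨i, hi, hij⟩ := hc
      refine (abs_indicator_sub_le w _ _).trans ?_
      have := Finset.single_le_sum (f := fun i => if cross i j then (1 : ℝ) else 0)
        (fun i _ => by split_ifs <;> norm_num) hi
      simpa [hij] using this
    · push Not at hc
      have hmem : θ + s + j * α ∈ matchSet α w ↔ θ + j * α ∈ matchSet α w := by
        have hcode : ∀ i : Fin l, code α (θ + s + j * α) i = code α (θ + j * α) i := by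
          intro i
          have h0 := hc i (Finset.mem_range.2 (by omega))
          have h1 := hc (i + 1) (Finset.mem_range.2 (by omega))
          simp only [cross, not_not] at h0 h1
          refine code_eq_of_floor (c := 0) ?_ ?_
          · rw [add_right_comm θ s, add_zero]
            exact_mod_cast h0
          · rw [add_right_comm θ s, add_zero]
            exact_mod_cast h1
        simp only [matchSet, Set.mem_ofPred_eq, hcode]
      have h0 : (matchSet α w).indicator (1 : ℝ → ℝ) (θ + s + j * α) =
          (matchSet α w).indicator 1 (θ + j * α) := by
        simp only [Set.indicator_apply, hmem, Pi.one_apply]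
      rw [h0, sub_self, abs_zero]
      exact Finset.sum_nonneg fun i _ => by split_ifs <;> norm_num
  have hcount : ∀ i : ℕ, (∑ j ∈ Finset.Icc 1 n, if cross i j then (1 : ℝ) else 0) ≤
      n / (den α (m + 1) : ℝ) + 1 := by
    intro i
    rw [Finset.sum_boole]
    have hcard : ((Finset.Icc 1 n).filter (cross i)).card ≤ n / den α (m + 1) + 1 := by
      refine card_le_of_separated (den_pos hα hα0 hα1 m)
        (fun j hj => (Finset.mem_Icc.1 (Finset.mem_filter.1 hj).1).2) ?_
      intro j hj j' hj' hjj
      have hcr : ∀ j, cross i j → ∃ z : ℤ, (i : ℝ) * α + (θ + j * α) < z ∧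
          (z : ℝ) ≤ (i : ℝ) * α + (θ + j * α) + s := by
        intro j hj
        by_contra! hcon
        refine hj ?_
        rw [← add_assoc]
        refine floor_add_eq_of_gap fun z => ⟨fun h => by linarith, fun h => ?_⟩
        by_contra! h'
        exact absurd (hcon z h') (by linarith)
      obtain ⟨z, hz, hz'⟩ := hcr j (Finset.mem_filter.1 hj).2
      obtain ⟨y, hy, hy'⟩ := hcr j' (Finset.mem_filter.1 hj').2
      by_contra! hlt
      have hb := gap_le_abs hα hα0 hα1 m (i := (j' : ℤ) - j) (by omega) (by omega) (y - z)
      push_cast at hb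
      have : |((j' : ℝ) - j) * α - (y - z)| ≤ s := by
        rw [abs_le]
        constructor <;> linarith
      linarith
    have h2 : ((n / den α (m + 1) : ℕ) : ℝ) ≤ n / (den α (m + 1) : ℝ) := Nat.cast_div_le
    have h3 : (((Finset.Icc 1 n).filter (cross i)).card : ℝ) ≤
        ((n / den α (m + 1) : ℕ) : ℝ) + 1 := by exact_mod_cast hcard
    linarith
  calc |visits α w (θ + s) n - visits α w θ n|
      = |∑ j ∈ Finset.Icc 1 n, ((matchSet α w).indicator (1 : ℝ → ℝ) (θ + s + j * α) -
          (matchSet α w).indicator 1 (θ + j * α))| := by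
        rw [visits, visits, Finset.sum_sub_distrib]
    _ ≤ ∑ j ∈ Finset.Icc 1 n, ∑ i ∈ Finset.range (l + 1), if cross i j then (1 : ℝ) else 0 :=
        (Finset.abs_sum_le_sum_abs _ _).trans (Finset.sum_le_sum fun j _ => hterm j)
    _ = ∑ i ∈ Finset.range (l + 1), ∑ j ∈ Finset.Icc 1 n, if cross i j then (1 : ℝ) else 0 :=
        Finset.sum_comm
    _ ≤ ∑ _i ∈ Finset.range (l + 1), (n / (den α (m + 1) : ℝ) + 1) :=
        Finset.sum_le_sum fun i _ => hcount i
    _ = _ := by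
        rw [Finset.sum_const, Finset.card_range, nsmul_eq_mul]
        push_cast
        ring

include hα hα0 hα1 in
lemma exists_abs_visits_sub_le (m : ℕ) :
    ∃ L : ℕ, ∀ (θ θ' : ℝ) (n : ℕ), |visits α w θ n - visits α w θ' n| ≤
      L + (l + 1) * (n / (den α (m + 1) : ℝ) + 1) := by
  obtain ⟨L, hL⟩ := exists_bounded_return hα hα0 hα1 (gap_pos hα hα0 hα1 m)
  refine ⟨L, fun θ θ' n => ?_⟩
  obtain ⟨k, hk, z, h0, h1⟩ := hL (θ' - θ)
  have hA := abs_visits_rotate_le w θ' (α := α) k n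
  have hB := abs_visits_translate_le w hα hα0 hα1 m h0 h1 θ n
  have heq : θ + (θ' - θ + k * α - z) = θ' + k * α + ((-z : ℤ) : ℝ) := by push_cast; ring
  rw [heq, visits_add_intCast] at hB
  have hk' : (k : ℝ) ≤ L := by exact_mod_cast hk
  rw [abs_le] at *
  constructor <;> linarith

lemma integral_visits (n : ℕ) :
    ∫ θ, visits α w θ n ∂circleMeasure = n * circleMeasure.real (matchSet α w) := by
  have hmeas : ∀ c : ℝ, MeasurableSet ((fun θ => θ + c) ⁻¹' matchSet α w) := fun c =>
    measurable_id.add_const c (measurableSet_matchSet w)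
  have hj : ∀ c : ℝ, ∫ θ, (matchSet α w).indicator (1 : ℝ → ℝ) (θ + c) ∂circleMeasure =
      circleMeasure.real (matchSet α w) := fun c => by
    rw [← circleMeasure_real_preimage_add (measurableSet_matchSet w)
      (fun θ => by exact_mod_cast add_intCast_mem_matchSet w θ 1) c,
      ← integral_indicator_one (hmeas c)]
    rfl
  simp only [visits]
  rw [integral_finsetSum]
  · simp [hj]
  · intro j _
    exact (integrable_const (1 : ℝ)).indicator (hmeas (j * α))

include hα hα0 hα1 in
/-- Words have frequencies: by `exists_abs_visits_sub_le` the visit frequencies of the orbit of `0`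
are uniformly close to their averages over the circle, which are equal to the measure of
`matchSet α w`. -/
lemma tendsto_occurrences : Tendsto (fun n : ℕ => (occurrences α w n : ℝ) / n) atTop
    (𝓝 (circleMeasure.real (matchSet α w))) := by
  rw [Metric.tendsto_atTop]
  intro ε hε
  have hden : Tendsto (fun m => ((l : ℝ) + 1) / (den α (m + 1) : ℝ)) atTop (𝓝 0) :=
    (tendsto_natCast_atTop_atTop.comp ((tendsto_den hα hα0 hα1).comp
      (tendsto_add_atTop_nat 1))).const_div_atTop _
  obtain ⟨m, hm⟩ := (hden.eventually (gt_mem_nhds (half_pos hε))).exists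
  obtain ⟨L, hL⟩ := exists_abs_visits_sub_le w hα hα0 hα1 m
  have hN : Tendsto (fun n : ℕ => ((L : ℝ) + (l + 1)) / (n : ℝ)) atTop (𝓝 0) :=
    tendsto_natCast_atTop_atTop.const_div_atTop _
  obtain ⟨N, hN⟩ := eventually_atTop.1 (hN.eventually (gt_mem_nhds (half_pos hε)))
  refine ⟨N + 1, fun n hn => ?_⟩
  have hn0 : (0 : ℝ) < n := by exact_mod_cast (by omega : 0 < n)
  have hint : Integrable (fun θ => visits α w θ n) circleMeasure := by
    refine integrable_finsetSum _ fun j _ => ?_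
    exact (integrable_const (1 : ℝ)).indicator
      (measurable_id.add_const (j * α) (measurableSet_matchSet w))
  have hdiff : |visits α w 0 n - n * circleMeasure.real (matchSet α w)| ≤
      L + (l + 1) * (n / (den α (m + 1) : ℝ) + 1) := by
    have h1 : visits α w 0 n - n * circleMeasure.real (matchSet α w) =
        ∫ θ, (visits α w 0 n - visits α w θ n) ∂circleMeasure := by
      rw [integral_sub (integrable_const _) hint, integral_visits, integral_const]
      simp
    rw [h1, ← Real.norm_eq_abs]
    refine (norm_integral_le_of_norm_le_const (Eventually.of_forall fun θ => ?_)).trans_eq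
      (by rw [probReal_univ, mul_one])
    exact hL 0 θ n
  rw [Real.dist_eq, occurrences_eq_visits w hα0]
  have h2 : visits α w 0 n / n - circleMeasure.real (matchSet α w) =
      (visits α w 0 n - n * circleMeasure.real (matchSet α w)) / n := by
    field_simp
  rw [h2, abs_div, abs_of_pos hn0, div_lt_iff₀ hn0]
  have h3 := hN n (by omega)
  rw [div_lt_iff₀ hn0] at h3
  have h4 := mul_lt_mul_of_pos_right hm hn0
  have h5 : ((l : ℝ) + 1) * (n / (den α (m + 1) : ℝ) + 1) =
      (l + 1) / (den α (m + 1) : ℝ) * n + (l + 1) := by ring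
  rw [h5] at hdiff
  linarith

end

/-! ### The measure of the hull -/

section

variable {α : ℝ} (hα : Irrational α) (hα0 : 0 < α) (hα1 : α < 1)

/-- The coding map from the line to the hull. -/
noncomputable def hullCode (θ : ℝ) : hull α := ⟨code α θ, code_mem_hull hα hα0 hα1 θ⟩

lemma measurable_hullCode : Measurable (hullCode hα hα0 hα1) :=
  (measurable_code α).subtype_mk

/-- The image of Lebesgue measure under the coding of the circle. -/
noncomputable def hullMeasure : Measure (hull α) := circleMeasure.map (hullCode hα hα0 hα1)

lemma measurable_eval (j : ℤ) : Measurable fun ω : hull α => ω.1 j :=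
  (measurable_pi_apply j).comp measurable_subtype_coe

lemma measurableSet_cylinder (m : ℤ) {l : ℕ} (w : Fin l → Fin 2) :
    MeasurableSet (cylinder α m w) := by
  have : cylinder α m w = ⋂ i : Fin l, {ω : hull α | ω.1 (m + (i : ℤ)) = w i} := by
    ext ω
    simp [cylinder]
  rw [this]
  exact MeasurableSet.iInter fun i => measurableSet_eq_fun (measurable_eval _) measurable_const

lemma isHullMeasure_hullMeasure : IsHullMeasure α (hullMeasure hα hα0 hα1) := by
  refine ⟨Measure.isProbabilityMeasure_map (measurable_hullCode hα hα0 hα1).aemeasurable, ?_⟩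
  intro m l w
  convert tendsto_occurrences w hα hα0 hα1 using 2
  rw [hullMeasure, map_measureReal_apply (measurable_hullCode hα hα0 hα1)
    (measurableSet_cylinder m w), ← circleMeasure_real_preimage_add (measurableSet_matchSet w)
      (fun θ => by exact_mod_cast add_intCast_mem_matchSet w θ 1) (m * α)]
  congr 1
  ext θ
  have h : ∀ i : ℤ, code α (θ + m * α) i = code α θ (m + i) := fun i => by
    have := code_add_int α θ m 0 i
    rwa [Int.cast_zero, add_zero, add_comm i] at this
  simp [cylinder, hullCode, matchSet, h]

/-- The cylinder sets over the windows `[-N, N]` form a generating `π`-system of the hull. -/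
lemma isHullMeasure_unique {μ ν : Measure (hull α)} (hμ : IsHullMeasure α μ)
    (hν : IsHullMeasure α ν) : ν = μ := by
  obtain ⟨hμ1, hμ⟩ := hμ
  obtain ⟨hν1, hν⟩ := hν
  let C : Set (Set (hull α)) :=
    {s | ∃ (N : ℕ) (w : Fin (2 * N + 1) → Fin 2), s = cylinder α (-N) w}
  refine ext_of_generate_finite C (le_antisymm ?_ ?_) ?_ ?_ (by simp)
  · rw [Subtype.instMeasurableSpace, MeasurableSpace.pi, MeasurableSpace.comap_iSup]
    refine iSup_le fun j => ?_
    rw [MeasurableSpace.comap_comp, ← measurable_iff_comap_le]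
    -- the coordinate `j` is a function of the pattern on the window `[-|j|, |j|]`
    let N := j.natAbs
    let r : hull α → Fin (2 * N + 1) → Fin 2 := fun ω i => ω.1 (-N + (i : ℤ))
    have hr : @Measurable _ _ (MeasurableSpace.generateFrom C) _ r := by
      refine @measurable_to_countable' _ _ _ _ (MeasurableSpace.generateFrom C) _ fun w => ?_
      refine MeasurableSpace.measurableSet_generateFrom ⟨N, w, ?_⟩
      ext ω
      simp [r, cylinder, funext_iff]
    have hj : (j + N).toNat < 2 * N + 1 := by omega
    have hcomp : ((fun b : Seq => b j) ∘ Subtype.val : hull α → Fin 2) =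
        (fun p : Fin (2 * N + 1) → Fin 2 => p ⟨(j + N).toNat, hj⟩) ∘ r := by
      funext ω
      have hidx : -(N : ℤ) + ((j + N).toNat : ℤ) = j := by omega
      simp only [Function.comp_apply, r, hidx]
    rw [hcomp]
    exact @Measurable.comp _ _ _ (MeasurableSpace.generateFrom C) _ _ _ _
      (measurable_pi_apply _) hr
  · refine MeasurableSpace.generateFrom_le ?_
    rintro s ⟨N, w, rfl⟩
    exact measurableSet_cylinder _ _
  · have key : ∀ (N M : ℕ) (w : Fin (2 * N + 1) → Fin 2) (w' : Fin (2 * M + 1) → Fin 2), N ≤ M →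
        (cylinder α (-N) w ∩ cylinder α (-M) w').Nonempty →
          cylinder α (-N) w ∩ cylinder α (-M) w' = cylinder α (-M) w' := by
      rintro N M w w' hNM ⟨ω₀, h0, h0'⟩
      refine Set.inter_eq_right.2 fun ω hω i => ?_
      have hi : (i : ℕ) + (M - N) < 2 * M + 1 := by omega
      have h1 := (hω ⟨(i : ℕ) + (M - N), hi⟩).trans (h0' ⟨(i : ℕ) + (M - N), hi⟩).symm
      have hidx : (-M : ℤ) + (((i : ℕ) + (M - N) : ℕ) : ℤ) = -N + (i : ℤ) := by
        push_cast [hNM]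
        ring
      simp only [hidx] at h1
      rw [h1, h0 i]
    rintro _ ⟨N, w, rfl⟩ _ ⟨M, w', rfl⟩ hne
    rcases le_total N M with h | h
    · exact ⟨M, w', key N M w w' h hne⟩
    · rw [Set.inter_comm] at hne ⊢
      exact ⟨N, w, key M N w' w h hne⟩
  · rintro _ ⟨N, w, rfl⟩
    have h := tendsto_nhds_unique (hν (-N) _ w) (hμ (-N) _ w)
    exact (measureReal_eq_measureReal_iff).1 h

end

/-! ### The measure of the squares -/

/-- The preimage in the line of an interval `[a, b)` of the circle, shifted by `c`, has measure at
least `b - a` (and in fact equal to it). -/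
lemma sub_le_circleMeasure_arc {a b : ℝ} (hab : a ≤ b) (hab1 : b - a ≤ 1) (c : ℝ) :
    MeasurableSet {θ : ℝ | ∃ m : ℤ, a ≤ θ + c - m ∧ θ + c - m < b} ∧
    b - a ≤ circleMeasure.real {θ : ℝ | ∃ m : ℤ, a ≤ θ + c - m ∧ θ + c - m < b} := by
  let A : Set ℝ := {θ : ℝ | Int.fract θ < b - a}
  have hA : MeasurableSet A := measurableSet_lt measurable_fract measurable_const
  have hper : ∀ θ, θ + 1 ∈ A ↔ θ ∈ A := fun θ => by
    simp only [A, Set.mem_ofPred_eq, Int.fract_add_one]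
  have hset : {θ : ℝ | ∃ m : ℤ, a ≤ θ + c - m ∧ θ + c - m < b} =
      (fun θ => θ + (c - a)) ⁻¹' A := by
    ext θ
    simp only [A, Set.mem_ofPred_eq, Set.mem_preimage]
    constructor
    · rintro ⟨m, h0, h1⟩
      have : Int.fract (θ + (c - a)) = θ + (c - a) - m :=
        Int.fract_eq_iff.2 ⟨by linarith, by linarith, m, by ring⟩
      rw [this]
      linarith
    · intro h
      have h0 := Int.fract_nonneg (θ + (c - a))
      have h1 := Int.self_sub_floor (θ + (c - a))
      exact ⟨⌊θ + (c - a)⌋, by linarith, by linarith⟩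
  rw [hset]
  have hm : Measurable fun θ : ℝ => θ + (c - a) := measurable_id.add_const _
  refine ⟨hm hA, ?_⟩
  rw [circleMeasure_real_preimage_add hA hper]
  have hsub : Set.Ioo 0 (b - a) ⊆ A := fun θ hθ => by
    simp only [A, Set.mem_ofPred_eq]
    rw [Int.fract_eq_self.2 ⟨hθ.1.le, hθ.2.trans_le hab1⟩]
    exact hθ.2
  have hvol : circleMeasure.real (Set.Ioo 0 (b - a)) = b - a := by
    rw [circleMeasure, measureReal_restrict_apply measurableSet_Ioo, Set.inter_eq_left.2,
      Real.volume_real_Ioo_of_le (by linarith), sub_zero]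
    exact fun θ hθ => ⟨hθ.1, hθ.2.le.trans hab1⟩
  rw [← hvol]
  exact measureReal_mono hsub

lemma measurableSet_squareSet (α : ℝ) (n : ℕ) : MeasurableSet (squareSet α n) := by
  have : squareSet α n = ⋃ k ∈ Finset.range (den α n), ⋂ j ∈ Finset.Icc (1 : ℤ) (2 * den α n),
      {ω : Seq | ω j = periodicWord α n (j - k)} := by
    ext ω
    simp [squareSet]
  rw [this]
  exact Finset.measurableSet_biUnion _ fun k _ => Finset.measurableSet_biInter _ fun j _ =>
    measurableSet_eq_fun (measurable_pi_apply _) measurable_const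

section

variable {α : ℝ} (hα : Irrational α) (hα0 : 0 < α) (hα1 : α < 1)

include hα hα0 hα1 in
/-- Lower bound for the measure of the squares at the scale `q_{n+1}`. The `q_{n+1}` rotated copies
of the interval of `code_block` are pairwise disjoint, because the points `k α` with
`0 ≤ k < q_{n+1}` have distances at least `gap α n` on the circle. -/
lemma eventually_le_circleMeasure_square :
    ∀ᶠ n in atTop, den α (n + 1) * (gap α n - gap α (n + 1)) ≤
      circleMeasure.real {θ | code α θ ∈ squareSet α (n + 1)} := by
  have hg := (tendsto_gap hα hα0 hα1).const_mul 2
  rw [mul_zero] at hg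
  filter_upwards [hg.eventually (gt_mem_nhds hα0),
    hg.eventually (gt_mem_nhds (sub_pos.2 hα1))] with n h2 h1
  have hgn := gap_pos hα hα0 hα1 n
  have hgn1 := gap_pos hα hα0 hα1 (n + 1)
  have hlt := gap_succ_lt hα hα0 hα1 n
  obtain ⟨a, b, hab, hJ⟩ : ∃ a b : ℝ, b - a = gap α n - gap α (n + 1) ∧ ∀ t, a ≤ t → t < b →
      (0 < den α (n + 1) * α - num α (n + 1) ∧ 0 ≤ t ∧
          t + (den α (n + 1) * α - num α (n + 1)) < gap α n) ∨
        (den α (n + 1) * α - num α (n + 1) < 0 ∧ t < 0 ∧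
          -gap α n ≤ t + (den α (n + 1) * α - num α (n + 1))) := by
    rw [den_mul_sub_num]
    rcases neg_one_pow_eq_or ℝ (n + 1 + 1) with h | h <;> rw [h]
    · refine ⟨0, gap α n - gap α (n + 1), by ring, fun t h0 ht => Or.inl ⟨?_, ?_, ?_⟩⟩ <;> linarith
    · refine ⟨-(gap α n - gap α (n + 1)), 0, by ring, fun t h0 ht => Or.inr ⟨?_, ?_, ?_⟩⟩ <;>
        linarith
  let A : ℕ → Set ℝ := fun k => {θ | ∃ m : ℤ, a ≤ θ + k * α - m ∧ θ + k * α - m < b}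
  have hA : ∀ k, MeasurableSet (A k) ∧ b - a ≤ circleMeasure.real (A k) := fun k =>
    sub_le_circleMeasure_arc (by linarith) (by linarith) (k * α)
  have hdisj : ∀ k < den α (n + 1), ∀ k' < den α (n + 1), k < k' → Disjoint (A k) (A k') := by
    intro k hk k' hk' hkk
    rw [Set.disjoint_left]
    rintro θ ⟨m, h0, h1⟩ ⟨m', h0', h1'⟩
    have hb := gap_le_abs hα hα0 hα1 n (i := (k' : ℤ) - k) (by omega) (by omega) (m' - m)
    push_cast at hb
    have : |((k' : ℝ) - k) * α - (m' - m)| < b - a := by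
      rw [abs_lt]
      constructor <;> linarith
    linarith
  have hsub : (⋃ k ∈ Finset.range (den α (n + 1)), A k) ⊆
      {θ | code α θ ∈ squareSet α (n + 1)} := by
    intro θ hθ
    simp only [Set.mem_iUnion, Finset.mem_range] at hθ
    obtain ⟨k, hk, m, h0, h1'⟩ := hθ
    obtain ⟨hper, hword⟩ := code_block rfl
      (fun i hi hi' => gap_le_abs' hα hα0 hα1 n hi hi') (by linarith) h2 (hJ _ h0 h1')
    have hpw : ∀ j : ℤ, 1 ≤ j → j ≤ den α (n + 1) →
        code α (θ + k * α - m) j = periodicWord α (n + 1) j := fun j hj hj' => by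
      rw [hword j hj hj', periodicWord_eq hj hj', word_eq_code hα0]
    refine ⟨k, hk, fun j hj hj' => ?_⟩
    have hshift : code α θ j = code α (θ + k * α - m) (j - k) := by
      have := code_add_int α θ k (-m) (j - k)
      rw [sub_add_cancel] at this
      rw [← this]
      push_cast
      rw [← sub_eq_add_neg]
    rw [hshift]
    rcases lt_or_ge (j - k) 1 with hlow | hlow
    · rw [← hper _ (by omega) (by omega), hpw _ (by omega) (by omega), periodicWord_add]
    rcases le_or_gt (j - k) (den α (n + 1)) with hmid | hhigh
    · exact hpw _ hlow hmid
    · have h3 := hper (j - k - den α (n + 1)) (by omega) (by omega)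
      have h4 := periodicWord_add α (n + 1) (j - k - den α (n + 1))
      rw [sub_add_cancel] at h3 h4
      rw [h3, h4, hpw _ (by omega) (by omega)]
  calc den α (n + 1) * (gap α n - gap α (n + 1))
      = ∑ _k ∈ Finset.range (den α (n + 1)), (b - a) := by
        rw [Finset.sum_const, Finset.card_range, nsmul_eq_mul, hab]
    _ ≤ ∑ k ∈ Finset.range (den α (n + 1)), circleMeasure.real (A k) :=
        Finset.sum_le_sum fun k _ => (hA k).2
    _ = circleMeasure.real (⋃ k ∈ Finset.range (den α (n + 1)), A k) := by
        rw [measureReal_biUnion_finset _ fun k _ => (hA k).1]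
        intro k hk k' hk' hne
        rw [Finset.coe_range, Set.mem_Iio] at hk hk'
        rcases lt_or_gt_of_ne hne with h | h
        · exact hdisj k hk k' hk' h
        · exact (hdisj k' hk' k hk h).symm
    _ ≤ _ := measureReal_mono hsub

include hα hα0 hα1 in
/-- If the gap decreases by a factor close to `1` at one step, then it decreases by a factor less
than `1 / 3` at the next one. -/
lemma frequently_le_den_mul :
    ∃ᶠ n in atTop, 1 / 8 ≤ (den α (n + 1) : ℝ) * (gap α n - gap α (n + 1)) := by
  rw [frequently_atTop]
  intro N
  have hhalf : ∀ n, 1 / 2 ≤ den α (n + 1) * gap α n := fun n => by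
    have h1 := den_mul_gap α n
    have h2 : (den α n : ℝ) ≤ den α (n + 1) := by exact_mod_cast den_le_succ hα hα0 hα1 n
    nlinarith [gap_pos hα hα0 hα1 (n + 1), gap_succ_lt hα hα0 hα1 n,
      Nat.cast_nonneg (α := ℝ) (den α (n + 1))]
  have hq : ∀ n, (0 : ℝ) < den α (n + 1) := fun n => by exact_mod_cast den_pos hα hα0 hα1 n
  rcases le_or_gt (gap α (N + 1)) (3 / 4 * gap α N) with h | h
  · exact ⟨N, le_rfl, by nlinarith [hhalf N, hq N]⟩
  · refine ⟨N + 1, by omega, ?_⟩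
    have hd : (1 : ℝ) ≤ digit α N := by exact_mod_cast one_le_digit hα hα0 hα1 N
    have h2 : gap α (N + 2) ≤ gap α N - gap α (N + 1) := by
      rw [gap_add_two]
      nlinarith [gap_pos hα hα0 hα1 (N + 1)]
    have h3 : gap α (N + 2) ≤ 1 / 3 * gap α (N + 1) := by linarith
    have h4 := hhalf (N + 1)
    show 1 / 8 ≤ (den α (N + 2) : ℝ) * (gap α (N + 1) - gap α (N + 2))
    nlinarith [hq (N + 1)]

end

lemma le_measure_limsup {X : Type*} [MeasurableSpace X] {μ : Measure X} [IsFiniteMeasure μ]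
    {G : ℕ → Set X} (hG : ∀ n, MeasurableSet (G n)) {c : ENNReal}
    (h : ∃ᶠ n in atTop, c ≤ μ (G n)) : c ≤ μ (limsup G atTop) := by
  have hU : ∀ N, MeasurableSet (⋃ n ≥ N, G n) := fun N =>
    MeasurableSet.iUnion fun n => MeasurableSet.iUnion fun _ => hG n
  have hset : limsup G atTop = ⋂ N, ⋃ n ≥ N, G n := by
    ext x
    simp [mem_limsup_iff_frequently_mem, frequently_atTop]
  rw [hset]
  have hanti : Antitone fun N => ⋃ n ≥ N, G n := fun N M hNM =>
    Set.biUnion_subset_biUnion_left fun n hn => le_trans hNM hn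
  refine ge_of_tendsto (tendsto_measure_iInter_atTop (μ := μ)
    (fun N => (hU N).nullMeasurableSet) hanti ⟨0, measure_ne_top _ _⟩)
    (Eventually.of_forall fun N => ?_)
  obtain ⟨n, hn, hc⟩ := frequently_atTop.1 h N
  exact hc.trans (measure_mono (Set.subset_biUnion_of_mem (u := G) hn))

end Sturmian

theorem theorem3p1 (α : ℝ) (hα : Irrational α) (hα0 : 0 < α) (hα1 : α < 1) :
    ∃ μ : Measure (Sturmian.hull α),
      (Sturmian.IsHullMeasure α μ ∧ ∀ ν, Sturmian.IsHullMeasure α ν → ν = μ) ∧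
      ∀ lam : ℝ, ∃ S : Set ℝ,
        Sturmian.IsAlmostSureSpectrum α lam μ S ∧
        Sturmian.HasPositiveMeasure μ (Sturmian.stabilitySet α lam S) := by
  have hhull := Sturmian.isHullMeasure_hullMeasure hα hα0 hα1
  have hprob : IsProbabilityMeasure (Sturmian.hullMeasure hα hα0 hα1) := hhull.1
  refine ⟨Sturmian.hullMeasure hα hα0 hα1,
    ⟨hhull, fun ν hν => Sturmian.isHullMeasure_unique hhull hν⟩, fun lam => ?_⟩
  refine ⟨{E | (E : ℂ) ∈ spectrum ℂ (Sturmian.sturmOp lam (Sturmian.word α))}, ⟨?_, ?_⟩, ?_⟩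
  · exact (spectrum.isClosed _).preimage Complex.continuous_ofReal
  · refine ae_of_all _ fun ω => ?_
    rw [Sturmian.spectrum_eq_of_mem_hull hα hα0 hα1 lam ω.2]
    ext z
    constructor
    · intro hz
      have hre := (Sturmian.isSelfAdjoint_sturmOp lam (Sturmian.word α)).mem_spectrum_eq_re hz
      exact ⟨z.re, show ((z.re : ℝ) : ℂ) ∈ _ from hre ▸ hz, hre.symm⟩
    · rintro ⟨E, hE, rfl⟩
      exact hE
  · let G : ℕ → Set (Sturmian.hull α) := fun n => Subtype.val ⁻¹' Sturmian.squareSet α n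
    have hG : ∀ n, MeasurableSet (G n) := fun n =>
      measurable_subtype_coe (Sturmian.measurableSet_squareSet α n)
    refine ⟨limsup G atTop, fun ω hω E hE => Or.inl fun φ hφ hsol => ?_,
      MeasurableSet.measurableSet_limsup hG, ?_⟩
    · exact Sturmian.not_sqSummable_of_frequently_square hα hα0 hα1
        ((mem_limsup_iff_frequently_mem (s := G)).1 hω)
        (Sturmian.abs_blockTrace_le hα hα0 hα1
          (Sturmian.not_escapes_of_mem_spectrum hα hα0 hα1 hE)) hφ hsol
    · refine lt_of_lt_of_le (by norm_num : (0 : ENNReal) < ENNReal.ofReal (1 / 8))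
        (Sturmian.le_measure_limsup hG ?_)
      have hfreq := (Sturmian.frequently_le_den_mul hα hα0 hα1).and_eventually
        (Sturmian.eventually_le_circleMeasure_square hα hα0 hα1)
      refine (tendsto_add_atTop_nat 1).frequently (hfreq.mono ?_)
      rintro n ⟨h1, h2⟩
      rw [← ofReal_measureReal]
      refine ENNReal.ofReal_le_ofReal ((h1.trans h2).trans_eq ?_)
      rw [Sturmian.hullMeasure,
        map_measureReal_apply (Sturmian.measurable_hullCode hα hα0 hα1) (hG _)]
      rfl
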